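/- Let $S$ be a finite totally ordered set (for example a finite set of natural numbers) of cardinality $2k$, and let $\mathcal B$ be a building set on $S$, that is, a collection of nonempty subsets of $S$ which contains $\{i\}$ for every $i\in S$, and which contains $I\cup J$ whenever $I,J\in\mathcal B$ and $I\cap J\neq\emptyset$. For $I\subseteq S$ put $\mathcal B|_I=\{J\in\mathcal B : J\subseteq I\}$; the connected components of a building set are its inclusion-maximal members, and a component has odd order if its cardinality is odd. Assume that $\mathcal B$ is chordal, i.e. for every $I=\{i_1<\cdots<i_r\}\in\mathcal B$ and every $1\le s\le r$ also $\{i_s,\ldots,i_r\}\in\mathcal B$, and that $\mathcal B$ has no connected component of odd order. Let $$\widehat{\mathcal P}_{\mathcal B}=\{I\subseteq S : \mathcal B|_I \text{ has no connected component of odd order}\},\qquad \mathcal P_{\mathcal B}=\widehat{\mathcal P}_{\mathcal B}\setminus\{\emptyset,S\},$$ ordered by inclusion, and let $\Delta(\mathcal P_{\mathcal B})$ be the order complex of $\mathcal P_{\mathcal B}$, i.e. the simplicial complex whose faces are the finite chains of $\mathcal P_{\mathcal B}$. Then $\Delta(\mathcal P_{\mathcal B})$ is shellable: it is pure, say of dimension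 $d$, and its maximal simplices can be ordered as $F_1,F_2,\ldots,F_m$ so that $F_j\cap\bigcup_{i<j}F_i$ is pure of dimension $d-1$ for every $j\ge 2$ (here the empty simplex counts as a simplex of dimension $-1$). Moreover, if $k\ge 2$, then the geometric realization of $\Delta(\mathcal P_{\mathcal B})$ is homotopy equivalent to a bouquet of finitely many spheres of dimension $k-2$; that is, there is an integer $\mathrm{alt}(\mathcal B)\ge 0$, the number of spheres, such that $$\Delta(\mathcal P_{\mathcal B})\simeq\bigvee^{\mathrm{alt}(\mathcal B)}S^{k-2},$$ where a bouquet of $0$ spheres is a point. -/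

import Mathlib

open scoped ContinuousMap

/-! ### Building sets -/

/-- `B` is a building set on the finite set `S`: a collection of nonempty subsets of `S` that
contains all singletons and the union of any two of its members that intersect. -/
structure IsBuildingSet {α : Type*} [DecidableEq α] (S : Finset α) (B : Set (Finset α)) :
    Prop where
  subset : ∀ I ∈ B, I ⊆ S
  nonempty : ∀ I ∈ B, I.Nonempty
  singleton_mem : ∀ i ∈ S, {i} ∈ B
  union_mem : ∀ I ∈ B, ∀ J ∈ B, (I ∩ J).Nonempty → I ∪ J ∈ B

/-- `B` is chordal: with every `I = {i₁ < ⋯ < iᵣ}` it contains each final segment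
`{iₛ, …, iᵣ}`. (For `s = 1` and `s = r` this is automatic in a building set.) -/
def IsChordal {α : Type*} [LinearOrder α] (B : Set (Finset α)) : Prop :=
  ∀ I ∈ B, ∀ a ∈ I, I.filter (fun x => a ≤ x) ∈ B

/-- The restriction of `B` to `I`: all members of `B` that are contained in `I`. -/
def restrictTo {α : Type*} (B : Set (Finset α)) (I : Finset α) : Set (Finset α) :=
  {J | J ∈ B ∧ J ⊆ I}

/-- A connected component of `B` is an inclusion-maximal member of `B`. -/
def IsComponent {α : Type*} (B : Set (Finset α)) (C : Finset α) : Prop :=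
  Maximal (fun J => J ∈ B) C

/-- `B` has no connected component of odd order. -/
def NoOddComponent {α : Type*} (B : Set (Finset α)) : Prop :=
  ∀ C, IsComponent B C → ¬ Odd C.card

/-- The poset, ordered by inclusion, of all subsets `I` of `S` such that the restriction of `B`
to `I` has no connected component of odd order. -/
def evenPoset {α : Type*} (S : Finset α) (B : Set (Finset α)) : Set (Finset α) :=
  {I | I ⊆ S ∧ NoOddComponent (restrictTo B I)}

/-- The proper part of `evenPoset S B`, obtained by removing `∅` and `S`. -/
def properPart {α : Type*} (S : Finset α) (B : Set (Finset α)) : Set (Finset α) :=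
  evenPoset S B \ {∅, S}

instance properPart_finite {α : Type*} (S : Finset α) (B : Set (Finset α)) :
    Finite (properPart S B) :=
  Set.Finite.subset (Finset.finite_toSet S.powerset)
    (fun _ hI => Finset.mem_coe.2 (Finset.mem_powerset.2 hI.1.1))

/-! ### Simplicial complexes -/

/-- The order complex of a poset: its faces are the nonempty finite chains. -/
def orderComplex (P : Type*) [PartialOrder P] : PreAbstractSimplicialComplex P where
  faces := {s | s.Nonempty ∧ IsChain (fun x y => x ≤ y) (s : Set P)}
  isRelLowerSet_faces := fun _ hs =>
    ⟨hs.1, fun _ hts ht => ⟨ht, hs.2.mono (Finset.coe_subset.2 hts)⟩⟩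

/-- The facets (maximal faces) of a simplicial complex. -/
def facetSet {V : Type*} (K : PreAbstractSimplicialComplex V) : Set (Finset V) :=
  {s | Maximal (fun t => t ∈ K.faces) s}

/-- A finite simplicial complex is shellable if it is pure, say of dimension `n - 1`, and its
facets can be listed as `F 0, F 1, …` so that, for every `j > 0`, the intersection of `F j` with
the union of the earlier facets is pure of dimension `n - 2`. Here the empty face, which has
dimension `-1`, belongs to that intersection, and the complex without nonempty faces has
dimension `-1`. -/
def IsShellable {V : Type*} (K : PreAbstractSimplicialComplex V) : Prop :=
  K.faces.Finite ∧
  ∃ n : ℕ, (∀ s ∈ facetSet K, s.card = n) ∧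
    ∃ (m : ℕ) (F : Fin m → Finset V),
      Function.Injective F ∧ Set.range F = facetSet K ∧
      ∀ j : Fin m, 0 < (j : ℕ) →
        ∀ t, Maximal (fun t => t ⊆ F j ∧ ∃ i < j, t ⊆ F i) t → t.card + 1 = n

/-- The geometric realization of a simplicial complex with finitely many vertices: the points of
`ℝ^V` that are convex combinations of the unit vectors of the vertices of a face. Its topology is
that of a subspace of `ℝ^V`. -/
def geomRealization {V : Type*} [Finite V] (K : PreAbstractSimplicialComplex V) : Set (V → ℝ) :=
  {x | ∃ s ∈ K.faces, (∀ v, 0 ≤ x v) ∧ (∀ v, v ∉ s → x v = 0) ∧ ∑ v ∈ s, x v = 1}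

/-! ### Bouquets of spheres -/

/-- The identifications in the wedge of a family of copies of `X` with base point `x₀`, indexed by
`ι`: an extra point and all the base points are glued together. -/
def wedgeSetoid (ι : Type*) {X : Type*} (x₀ : X) : Setoid (Unit ⊕ (Σ _ : ι, X)) where
  r p q := p = q ∨
    ((p = Sum.inl () ∨ ∃ i, p = Sum.inr ⟨i, x₀⟩) ∧ (q = Sum.inl () ∨ ∃ i, q = Sum.inr ⟨i, x₀⟩))
  iseqv :=
    { refl := fun _ => Or.inl rfl
      symm := by
        rintro p q (h | h)
        · exact Or.inl h.symm
        · exact Or.inr h.symm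
      trans := by
        rintro p q r (rfl | h) (rfl | h')
        · exact Or.inl rfl
        · exact Or.inr h'
        · exact Or.inr h
        · exact Or.inr ⟨h.1, h'.2⟩ }

/-- The unit sphere of dimension `d`, in `ℝ^(d+1)`. -/
abbrev unitSphere (d : ℕ) : Type :=
  Metric.sphere (0 : EuclideanSpace ℝ (Fin (d + 1))) 1

/-- A base point of the sphere. -/
noncomputable def sphereBase (d : ℕ) : unitSphere d :=
  ⟨EuclideanSpace.single 0 1, by simp⟩

/-- The bouquet of `n` spheres of dimension `d`, with the quotient topology; it is a point if
`n = 0`. -/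
abbrev sphereBouquet (n d : ℕ) : Type :=
  Quotient (wedgeSetoid (Fin n) (sphereBase d))

/-! Every set in the poset has even cardinality, and the covers of an even set `I` are the sets `I ∪
T` with `T` a two-element member of the contraction `contractBy B I` (`rankCover_iff`). Chordality
passes to contractions, and it makes the two largest elements of any member of size at least two a
member again (`topPair_mem`). Since an interval `[I, J]` is exhausted by even members of the
contraction, there is always a cover of `I` below `J`, and the poset is graded by half the
cardinality (`isRanked_evenPoset`).

The shelling comes from a recursive atom ordering in the sense of Björner and Wachs. At each `I` the
pairs are ordered so that the top pair of a member precedes all other pairs inside that member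
(`IsTopFirst`). Two facts make the recursion run. After a step by a pair `T`, the contraction again
has such an ordering, in which pairs lying above an earlier alternative to `T` come first
(`IsTopFirst.exists_contract`). If `T` and an earlier pair `W` lie in a common even set, then `T`
can be extended inside that set by a pair that lies above an earlier alternative
(`IsTopFirst.exists_exchange`). Comparing maximal chains lexicographically then gives the exchange
property (`IsRanked.exists_shelling_key`), which is a shelling (`isShellable_of_key`).

For the homotopy type, let `R j` be the set of vertices of the facet `F j` whose opposite face lies
in an earlier facet. Attaching a facet with `∅ ≠ R j ≠ F j` preserves contractibility
(`contractibleSpace_union_cell`); a facet with `R j = F j` is attached along its whole boundary.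
That boundary already lies in earlier facets of the first kind, so these can all be assembled first,
into a contractible space `A`. Collapsing `A` is a homotopy equivalence onto a bouquet with one
sphere for each remaining facet (`nonempty_homotopyEquiv_sphereBouquet`). -/

/-! ### Shellings from recursive atom orderings -/

section RecursiveAtomOrdering

variable {β : Type*} [PartialOrder β]

/-- `a` lies in `Q` above `x`, one rank higher. -/
def RankCover (Q : Set β) (r : β → ℕ) (x a : β) : Prop :=
  a ∈ Q ∧ x < a ∧ r a = r x + 1

/-- `r` is a rank function on `Q`, which has the greatest element `t`. -/
structure IsRanked (Q : Set β) (r : β → ℕ) (t : β) : Prop where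
  top_mem : t ∈ Q
  le_top : ∀ x ∈ Q, x ≤ t
  rank_lt : ∀ x ∈ Q, ∀ y ∈ Q, x < y → r x < r y
  exists_cover : ∀ x ∈ Q, ∀ y ∈ Q, x < y → ∃ a, RankCover Q r x a ∧ a ≤ y

/-- `F` is a chain of `Q` that contains `x`, lies in the interval `[x, t)`, and has an element of
each rank. -/
structure IsFullChain (Q : Set β) (r : β → ℕ) (t x : β) (F : Finset β) : Prop where
  mem : x ∈ F
  bounds : ∀ y ∈ F, y ∈ Q ∧ x ≤ y ∧ y < t
  chain : IsChain (fun y z => y ≤ z) (F : Set β)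
  card : F.card + r x = r t

variable {Q : Set β} {r : β → ℕ} {t x a : β} {F G : Finset β}

theorem IsRanked.eq_of_chain (h : IsRanked Q r t) (hF : IsChain (fun y z => y ≤ z) (F : Set β))
    (hQ : ∀ y ∈ F, y ∈ Q) {y z : β} (hy : y ∈ F) (hz : z ∈ F) (hr : r y = r z) : y = z := by
  by_contra hne
  rcases hF hy hz hne with hle | hle
  · exact absurd (h.rank_lt y (hQ y hy) z (hQ z hz) (lt_of_le_of_ne hle hne)) (by omega)
  · exact absurd (h.rank_lt z (hQ z hz) y (hQ y hy) (lt_of_le_of_ne hle (Ne.symm hne))) (by omega)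

theorem IsRanked.card_le (h : IsRanked Q r t) (hF : IsChain (fun y z => y ≤ z) (F : Set β))
    (hb : ∀ y ∈ F, y ∈ Q ∧ a ≤ y ∧ y < t) (ha : a ∈ Q) : F.card ≤ r t - r a := by
  have hinj : Set.InjOn r (F : Set β) := fun y hy z hz hr =>
    h.eq_of_chain hF (fun y hy => (hb y hy).1) hy hz hr
  have hmaps : ∀ y ∈ F, r y ∈ Finset.Ico (r a) (r t) := by
    intro y hy
    obtain ⟨hQ, hay, hyt⟩ := hb y hy
    refine Finset.mem_Ico.2 ⟨?_, h.rank_lt y hQ t h.top_mem hyt⟩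
    rcases eq_or_lt_of_le hay with rfl | hlt
    · exact le_rfl
    · exact (h.rank_lt a ha y hQ hlt).le
  have := Finset.card_le_card_of_injOn r hmaps hinj
  simpa using this

theorem IsFullChain.cover_unique (h : IsRanked Q r t) (hF : IsFullChain Q r t x F) {b : β}
    (ha : RankCover Q r x a) (haF : a ∈ F) (hb : RankCover Q r x b) (hbF : b ∈ F) : a = b :=
  h.eq_of_chain hF.chain (fun y hy => (hF.bounds y hy).1) haF hbF (ha.2.2.trans hb.2.2.symm)

theorem RankCover.lt_top (h : IsRanked Q r t) (ha : RankCover Q r x a) (hr : r x + 2 ≤ r t) :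
    a < t := by
  refine lt_of_le_of_ne (h.le_top a ha.1) ?_
  rintro rfl
  have := ha.2.2
  omega

variable [DecidableEq β]

/-- The cover is the least element `a` of `F.erase x`: the remaining `r t - r x - 1` elements lie in
`[a, t)` and have distinct ranks, which leaves no room for a rank above `r x + 1`. -/
theorem IsFullChain.exists_erase (h : IsRanked Q r t) (hF : IsFullChain Q r t x F)
    (hr : r x + 2 ≤ r t) : ∃ a, a ∈ F ∧ RankCover Q r x a ∧ IsFullChain Q r t a (F.erase x) := by
  have hcard : (F.erase x).card + 1 = F.card := Finset.card_erase_add_one hF.mem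
  have hFc := hF.card
  have hne : (F.erase x).Nonempty := Finset.card_pos.1 (by omega)
  obtain ⟨a, ha⟩ := (F.erase x).exists_minimal hne
  obtain ⟨hax, haF⟩ := Finset.mem_erase.1 ha.1
  have hle : ∀ y ∈ F.erase x, a ≤ y := by
    intro y hy
    by_cases hya : a = y
    · exact hya.le
    · rcases hF.chain haF (Finset.mem_of_mem_erase hy) hya with hle | hle
      · exact hle
      · exact ha.2 hy hle
  obtain ⟨haQ, hxa, hat⟩ := hF.bounds a haF
  have hxQ := (hF.bounds x hF.mem).1
  have hchain : IsChain (fun y z => y ≤ z) ((F.erase x : Finset β) : Set β) :=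
    hF.chain.mono (Finset.coe_subset.2 (Finset.erase_subset _ _))
  have hb : ∀ y ∈ F.erase x, y ∈ Q ∧ a ≤ y ∧ y < t := fun y hy =>
    ⟨(hF.bounds y (Finset.mem_of_mem_erase hy)).1, hle y hy,
      (hF.bounds y (Finset.mem_of_mem_erase hy)).2.2⟩
  have hlt := lt_of_le_of_ne hxa (Ne.symm hax)
  have h1 := h.card_le hchain hb haQ
  have h2 := h.rank_lt x hxQ a haQ hlt
  have h3 := h.rank_lt a haQ t h.top_mem hat
  refine ⟨a, haF, ⟨haQ, hlt, by omega⟩, ha.1, hb, hchain, by omega⟩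

theorem IsFullChain.insert_cover (hxQ : x ∈ Q) (ha : RankCover Q r x a) (hat : a < t)
    (hF : IsFullChain Q r t a F) : x ∉ F ∧ IsFullChain Q r t x (insert x F) := by
  have hx : x ∉ F := fun hx => absurd (hF.bounds x hx).2.1 (not_le_of_gt ha.2.1)
  refine ⟨hx, Finset.mem_insert_self _ _, ?_, ?_, ?_⟩
  · intro y hy
    rcases Finset.mem_insert.1 hy with rfl | hy
    · exact ⟨hxQ, le_rfl, ha.2.1.trans hat⟩
    · obtain ⟨h1, h2, h3⟩ := hF.bounds y hy
      exact ⟨h1, ha.2.1.le.trans h2, h3⟩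
  · rw [Finset.coe_insert]
    exact hF.chain.insert fun y hy _ => Or.inl (ha.2.1.le.trans (hF.bounds y hy).2.1)
  · rw [Finset.card_insert_of_notMem hx]
    have := hF.card
    have := ha.2.2
    omega

/-- A chain is refined greedily: step from `x` to a cover below the least remaining element of `c`,
and repeat. This gives purity, and it also supplies the auxiliary chains of the exchange argument.
-/
theorem IsRanked.exists_fullChain (h : IsRanked Q r t) (n : ℕ) : ∀ (x : β) (c : Finset β),
    x ∈ Q → r t = r x + n + 1 → (∀ y ∈ c, y ∈ Q ∧ x ≤ y ∧ y < t) →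
    IsChain (fun y z => y ≤ z) (c : Set β) → ∃ F, c ⊆ F ∧ IsFullChain Q r t x F := by
  induction n with
  | zero =>
    intro x c hx hr hc _
    have hxt : x < t := by
      refine lt_of_le_of_ne (h.le_top x hx) ?_
      rintro rfl
      omega
    refine ⟨{x}, ?_, Finset.mem_singleton_self x, ?_, ?_, ?_⟩
    · intro y hy
      obtain ⟨h1, h2, h3⟩ := hc y hy
      rw [Finset.mem_singleton]
      by_contra hne
      have h4 := h.rank_lt x hx y h1 (lt_of_le_of_ne h2 (Ne.symm hne))
      have h5 := h.rank_lt y h1 t h.top_mem h3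
      omega
    · intro y hy
      rw [Finset.mem_singleton.1 hy]
      exact ⟨hx, le_rfl, hxt⟩
    · simp
    · simp; omega
  | succ n ih =>
    intro x c hx hr hc hch
    have hxt : x < t := by
      refine lt_of_le_of_ne (h.le_top x hx) ?_
      rintro rfl
      omega
    obtain ⟨a, ha, hac⟩ : ∃ a, RankCover Q r x a ∧ ∀ y ∈ c.erase x, a ≤ y := by
      by_cases hne : (c.erase x).Nonempty
      · obtain ⟨y, hy⟩ := (c.erase x).exists_minimal hne
        obtain ⟨hyx, hyc⟩ := Finset.mem_erase.1 hy.1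
        obtain ⟨h1, h2, h3⟩ := hc y hyc
        obtain ⟨a, ha, hay⟩ := h.exists_cover x hx y h1 (lt_of_le_of_ne h2 (Ne.symm hyx))
        refine ⟨a, ha, fun z hz => ?_⟩
        by_cases hyz : y = z
        · exact hyz ▸ hay
        · rcases hch hyc (Finset.mem_of_mem_erase hz) hyz with hle | hle
          · exact hay.trans hle
          · exact hay.trans (hy.2 hz hle)
      · obtain ⟨a, ha, -⟩ := h.exists_cover x hx t h.top_mem hxt
        exact ⟨a, ha, fun y hy => absurd ⟨y, hy⟩ hne⟩
    have hat : a < t := ha.lt_top h (by omega)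
    obtain ⟨F, hcF, hF⟩ := ih a (c.erase x) ha.1 (by have := ha.2.2; omega)
      (fun y hy => ⟨(hc y (Finset.mem_of_mem_erase hy)).1, hac y hy,
        (hc y (Finset.mem_of_mem_erase hy)).2.2⟩)
      (hch.mono (Finset.coe_subset.2 (Finset.erase_subset _ _)))
    refine ⟨insert x F, ?_, (hF.insert_cover hx ha hat).2⟩
    intro y hy
    by_cases hyx : y = x
    · simp [hyx]
    · exact Finset.mem_insert_of_mem (hcF (Finset.mem_erase.2 ⟨hyx, hy⟩))

/-- Since `z` sits two ranks above `x`, all of `F` apart from `x` and `a` is above `z`, hence above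
`b`. -/
theorem IsFullChain.replace_cover (h : IsRanked Q r t) (hF : IsFullChain Q r t x F)
    (ha : RankCover Q r x a) (haF : a ∈ F) {b z : β} (hb : RankCover Q r x b)
    (hz : RankCover Q r a z) (hbz : b < z) (hzF : z ∈ F ∨ z = t) (hne : b ≠ a) :
    IsFullChain Q r t x (insert b (F.erase a)) := by
  have hbF : b ∉ F := fun hbF => hne (hF.cover_unique h hb hbF ha haF)
  have hzt : z ≤ t := h.le_top z hz.1
  have key : ∀ w ∈ F.erase a, w = x ∨ z ≤ w := by
    intro w hw
    obtain ⟨hwa, hwF⟩ := Finset.mem_erase.1 hw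
    by_cases hwx : w = x
    · exact Or.inl hwx
    right
    obtain ⟨hwQ, hxw, hwt⟩ := hF.bounds w hwF
    have h1 := h.rank_lt x (hF.bounds x hF.mem).1 w hwQ (lt_of_le_of_ne hxw (Ne.symm hwx))
    have h2 : r w ≠ r a := fun he =>
      hwa (h.eq_of_chain hF.chain (fun y hy => (hF.bounds y hy).1) hwF haF he)
    have h3 := ha.2.2
    have h4 := hz.2.2
    rcases hzF with hzF | rfl
    · by_cases hwz : z = w
      · exact hwz.le
      rcases hF.chain hzF hwF hwz with hle | hle
      · exact hle
      · have := h.rank_lt w hwQ z hz.1 (lt_of_le_of_ne hle (Ne.symm hwz))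
        omega
    · have := h.rank_lt w hwQ z hz.1 hwt
      omega
  refine ⟨?_, ?_, ?_, ?_⟩
  · exact Finset.mem_insert_of_mem (Finset.mem_erase.2 ⟨ha.2.1.ne, hF.mem⟩)
  · intro y hy
    rcases Finset.mem_insert.1 hy with rfl | hy
    · exact ⟨hb.1, hb.2.1.le, hbz.trans_le hzt⟩
    · exact hF.bounds y (Finset.mem_of_mem_erase hy)
  · rw [Finset.coe_insert]
    refine IsChain.insert (hF.chain.mono (Finset.coe_subset.2 (Finset.erase_subset _ _))) ?_
    intro y hy _
    rcases key y hy with rfl | hle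
    · exact Or.inr hb.2.1.le
    · exact Or.inl (hbz.le.trans hle)
  · rw [Finset.card_insert_of_notMem (fun hm => hbF (Finset.mem_of_mem_erase hm)),
      Finset.card_erase_add_one haF]
    exact hF.card

/-- A recursive atom ordering, given by keys `ψ` for the covers of the elements of a ranked poset,
yields a shelling order, given by keys `φ`, of the full chains. -/
theorem IsRanked.exists_shelling_key {Λ : Type*} [LinearOrder Λ] (h : IsRanked Q r t)
    (Good : β → (β → Λ) → Prop)
    (hinj : ∀ x ψ a b, Good x ψ → RankCover Q r x a → RankCover Q r x b → ψ a = ψ b → a = b)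
    (hchild : ∀ x ψ a, x ∈ Q → Good x ψ → RankCover Q r x a → ∃ ψ', Good a ψ' ∧
      ∀ z w, RankCover Q r a z → RankCover Q r a w →
        (∃ b, RankCover Q r x b ∧ ψ b < ψ a ∧ b < z) →
        (¬ ∃ b, RankCover Q r x b ∧ ψ b < ψ a ∧ b < w) → ψ' z < ψ' w)
    (hexch : ∀ x ψ a b y, x ∈ Q → Good x ψ → RankCover Q r x a → RankCover Q r x b →
      ψ b < ψ a → y ∈ Q → a < y → b < y →
      ∃ z, z ≤ y ∧ RankCover Q r a z ∧ ∃ b', RankCover Q r x b' ∧ ψ b' < ψ a ∧ b' < z) (n : ℕ) :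
    ∀ (x : β) (ψ : β → Λ), x ∈ Q → r t = r x + n + 1 → Good x ψ →
      ∃ φ : Finset β → List Λ,
        (∀ F G, IsFullChain Q r t x F → IsFullChain Q r t x G → φ F = φ G → F = G) ∧
        (∀ F G, IsFullChain Q r t x F → IsFullChain Q r t x G → φ G < φ F →
          ∃ G', IsFullChain Q r t x G' ∧ φ G' < φ F ∧ ∃ v ∈ F, v ∉ G ∧ F.erase v ⊆ G') ∧
        (∀ F G, IsFullChain Q r t x F → IsFullChain Q r t x G →
          ∀ a ∈ F, ∀ b ∈ G, RankCover Q r x a → RankCover Q r x b → ψ b < ψ a → φ G < φ F) := by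
  classical
  induction n with
  | zero =>
    intro x ψ hx hr _
    have hsing : ∀ F, IsFullChain Q r t x F → F = {x} := by
      intro F hF
      have hFc := hF.card
      obtain ⟨y, rfl⟩ := Finset.card_eq_one.1 (by omega : F.card = 1)
      rw [Finset.mem_singleton.1 hF.mem]
    refine ⟨fun _ => [], fun F G hF hG _ => (hsing F hF).trans (hsing G hG).symm,
      fun F G _ _ hlt => absurd hlt (lt_irrefl _), ?_⟩
    intro F G hF _ a ha b _ hac
    rw [hsing F hF, Finset.mem_singleton] at ha
    exact absurd ha hac.2.1.ne'
  | succ n ih =>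
    intro x ψ hx hr hgood
    have hr2 : r x + 2 ≤ r t := by omega
    have hsub : ∀ a, ∃ (ψa : β → Λ) (φa : Finset β → List Λ), RankCover Q r x a →
        (∀ z w, RankCover Q r a z → RankCover Q r a w →
          (∃ b, RankCover Q r x b ∧ ψ b < ψ a ∧ b < z) →
          (¬ ∃ b, RankCover Q r x b ∧ ψ b < ψ a ∧ b < w) → ψa z < ψa w) ∧
        (∀ F G, IsFullChain Q r t a F → IsFullChain Q r t a G → φa F = φa G → F = G) ∧
        (∀ F G, IsFullChain Q r t a F → IsFullChain Q r t a G → φa G < φa F →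
          ∃ G', IsFullChain Q r t a G' ∧ φa G' < φa F ∧ ∃ v ∈ F, v ∉ G ∧ F.erase v ⊆ G') ∧
        (∀ F G, IsFullChain Q r t a F → IsFullChain Q r t a G →
          ∀ z ∈ F, ∀ w ∈ G, RankCover Q r a z → RankCover Q r a w → ψa w < ψa z →
            φa G < φa F) := by
      intro a
      by_cases ha : RankCover Q r x a
      · obtain ⟨ψa, hψa, hfirst⟩ := hchild x ψ a hx hgood ha
        obtain ⟨φa, h1, h2, h3⟩ := ih a ψa ha.1 (by have := ha.2.2; omega) hψa
        exact ⟨ψa, φa, fun _ => ⟨hfirst, h1, h2, h3⟩⟩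
      · exact ⟨ψ, fun _ => [], fun ha' => absurd ha' ha⟩
    choose ψs φs hs using hsub
    have hm : ∀ F, ∃ a, IsFullChain Q r t x F →
        a ∈ F ∧ RankCover Q r x a ∧ IsFullChain Q r t a (F.erase x) := by
      intro F
      by_cases hF : IsFullChain Q r t x F
      · obtain ⟨a, ha⟩ := hF.exists_erase h hr2
        exact ⟨a, fun _ => ha⟩
      · exact ⟨x, fun hF' => absurd hF' hF⟩
    choose m hm using hm
    have hm_eq : ∀ F a, IsFullChain Q r t x F → a ∈ F → RankCover Q r x a → m F = a :=
      fun F a hF haF ha => hF.cover_unique h (hm F hF).2.1 (hm F hF).1 ha haF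
    have hlt_iff : ∀ F G, ψ (m G) :: φs (m G) (G.erase x) < ψ (m F) :: φs (m F) (F.erase x) ↔
        ψ (m G) < ψ (m F) ∨
          ψ (m G) = ψ (m F) ∧ φs (m G) (G.erase x) < φs (m F) (F.erase x) :=
      fun F G => List.cons_lt_cons_iff
    have hthird : ∀ F G, IsFullChain Q r t x F → IsFullChain Q r t x G →
          ∀ a ∈ F, ∀ b ∈ G, RankCover Q r x a → RankCover Q r x b → ψ b < ψ a →
          ψ (m G) :: φs (m G) (G.erase x) < ψ (m F) :: φs (m F) (F.erase x) := by
      intro F G hF hG a haF b hbG ha hb hlt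
      rw [hlt_iff, hm_eq F a hF haF ha, hm_eq G b hG hbG hb]
      exact Or.inl hlt
    have hinsert : ∀ F G', IsFullChain Q r t x F → IsFullChain Q r t (m F) G' →
        φs (m F) G' < φs (m F) (F.erase x) → IsFullChain Q r t x (insert x G') ∧
          ψ (m (insert x G')) :: φs (m (insert x G')) ((insert x G').erase x) <
            ψ (m F) :: φs (m F) (F.erase x) := by
      intro F G' hF hG' hlt
      obtain ⟨hmF, hmc, hme⟩ := hm F hF
      obtain ⟨hxG, hG⟩ := hG'.insert_cover hx hmc (hmc.lt_top h hr2)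
      refine ⟨hG, ?_⟩
      rw [hlt_iff, hm_eq _ _ hG (Finset.mem_insert_of_mem hG'.mem) hmc,
        Finset.erase_insert hxG]
      exact Or.inr ⟨rfl, hlt⟩
    -- The key of a chain lists the keys of its successive covers, each in the ordering attached to
    -- the preceding step; lists are compared lexicographically.
    refine ⟨fun F => ψ (m F) :: φs (m F) (F.erase x), ?_, ?_, hthird⟩
    · intro F G hF hG he
      obtain ⟨h1, h2⟩ := List.cons_eq_cons.1 he
      have hmm : m F = m G := hinj x ψ _ _ hgood (hm F hF).2.1 (hm G hG).2.1 h1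
      have hG2 := (hm G hG).2.2
      rw [← hmm] at h2 hG2
      have := (hs (m F) (hm F hF).2.1).2.1 _ _ (hm F hF).2.2 hG2 h2
      rw [← Finset.insert_erase hF.mem, this, Finset.insert_erase hG.mem]
    · intro F G hF hG hlt
      obtain ⟨haF, ha, hE⟩ := hm F hF
      obtain ⟨hbG, hb, hEG⟩ := hm G hG
      have hlt' := (hlt_iff F G).1 hlt
      set a := m F with ha_def
      set b := m G with hb_def
      obtain ⟨hfirst, -, hexs, hthird'⟩ := hs a ha
      rcases hlt' with hψ | ⟨hψ, hφ⟩
      · have hba : b ≠ a := fun he => hψ.ne (congrArg ψ he)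
        have haG : a ∉ G := fun haG => hba (hG.cover_unique h hb hbG ha haG)
        -- replacing `a` by an earlier cover
        have hrepl : ∀ z, RankCover Q r a z → (z ∈ F ∨ z = t) →
            (∃ b', RankCover Q r x b' ∧ ψ b' < ψ a ∧ b' < z) →
            ∃ G', IsFullChain Q r t x G' ∧ ψ (m G') :: φs (m G') (G'.erase x) <
              ψ a :: φs a (F.erase x) ∧ ∃ v ∈ F, v ∉ G ∧ F.erase v ⊆ G' := by
          rintro z hz hzF ⟨b', hb', hψ', hbz⟩
          have hne : b' ≠ a := fun he => hψ'.ne (congrArg ψ he)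
          have hfull := hF.replace_cover h ha haF hb' hz hbz hzF hne
          exact ⟨_, hfull, hthird F _ hF hfull a haF b' (Finset.mem_insert_self _ _) ha hb' hψ',
            a, haF, haG, Finset.subset_insert _ _⟩
        have hale : ∀ w ∈ F, w ≠ x → a ≤ w := fun w hw hwx =>
          (hE.bounds w (Finset.mem_erase.2 ⟨hwx, hw⟩)).2.1
        have hble : ∀ w ∈ G, w ≠ x → b ≤ w := fun w hw hwx =>
          (hEG.bounds w (Finset.mem_erase.2 ⟨hwx, hw⟩)).2.1
        -- `y` is the first place above `x` where `F` and `G` meet again, or `t` if they never do.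
        obtain ⟨y, hyQ, hay, hby, hyF, hyle⟩ : ∃ y ∈ Q, a < y ∧ b < y ∧ (y ∈ F ∨ y = t) ∧
            ∀ w ∈ F, w ∈ G → w ≠ x → y ≤ w := by
          by_cases hne : ((F ∩ G).erase x).Nonempty
          · obtain ⟨y, hy⟩ := ((F ∩ G).erase x).exists_minimal hne
            obtain ⟨hyx, hyFG⟩ := Finset.mem_erase.1 hy.1
            obtain ⟨hyF, hyG⟩ := Finset.mem_inter.1 hyFG
            have hay : a ≠ y := fun he => haG (he ▸ hyG)
            have hby : b ≠ y := fun he => hba (hF.cover_unique h hb (he ▸ hyF) ha haF)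
            refine ⟨y, (hF.bounds y hyF).1, lt_of_le_of_ne (hale y hyF hyx) hay,
              lt_of_le_of_ne (hble y hyG hyx) hby, Or.inl hyF, ?_⟩
            intro w hwF hwG hwx
            by_cases hyw : y = w
            · exact hyw.le
            rcases hF.chain hyF hwF hyw with hle | hle
            · exact hle
            · exact hy.2 (Finset.mem_erase.2 ⟨hwx, Finset.mem_inter.2 ⟨hwF, hwG⟩⟩) hle
          · exact ⟨t, h.top_mem, ha.lt_top h hr2, hb.lt_top h hr2, Or.inr rfl,
              fun w hwF hwG hwx => absurd
                ⟨w, Finset.mem_erase.2 ⟨hwx, Finset.mem_inter.2 ⟨hwF, hwG⟩⟩⟩ hne⟩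
        obtain ⟨z, hzy, hz, hzb⟩ := hexch x ψ a b y hx hgood ha hb hψ hyQ hay hby
        by_cases hzF : z ∈ F ∨ z = t
        · exact hrepl z hz hzF hzb
        push Not at hzF
        have hzt : z < t := lt_of_le_of_ne (h.le_top z hz.1) hzF.2
        have hrz := h.rank_lt z hz.1 t h.top_mem hzt
        have hraz := hz.2.2
        obtain ⟨a', ha'E, ha', -⟩ := hE.exists_erase h (by omega)
        -- If the second step `a'` of `F` lies above an earlier cover of `x`, then `a` can be
        -- replaced directly. Otherwise `z` precedes `a'` in the ordering at `a`, and induction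
        -- applies to a chain through `z`.
        by_cases hearly : ∃ b', RankCover Q r x b' ∧ ψ b' < ψ a ∧ b' < a'
        · exact hrepl a' ha' (Or.inl (Finset.mem_of_mem_erase ha'E)) hearly
        have hψz := hfirst z a' hz ha' hzb hearly
        have hra := ha.2.2
        -- The auxiliary chain keeps every element of `F` above `z`. The vertex `v` dropped by
        -- induction is therefore not above `z`, whereas the common elements of `F` and `G` other
        -- than `x` are above `y ≥ z`; so `v ∉ G`.
        obtain ⟨G'', hcG, hG''⟩ := h.exists_fullChain n a
          (insert z ((F.erase x).filter fun w => z ≤ w)) ha.1 (by omega)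
          (by
            intro w hw
            rcases Finset.mem_insert.1 hw with rfl | hw
            · exact ⟨hz.1, hz.2.1.le, hzt⟩
            · exact hE.bounds w (Finset.mem_filter.1 hw).1)
          (by
            rw [Finset.coe_insert]
            refine IsChain.insert (hE.chain.mono
              (Finset.coe_subset.2 (Finset.filter_subset _ _))) ?_
            intro w hw _
            exact Or.inl (Finset.mem_filter.1 hw).2)
        obtain ⟨G', hG', hφ', v, hvE, hvG, hsubs⟩ := hexs _ _ hE hG''
          (hthird' _ _ hE hG'' a' ha'E z (hcG (Finset.mem_insert_self _ _)) ha' hz hψz)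
        obtain ⟨hvx, hvF⟩ := Finset.mem_erase.1 hvE
        obtain ⟨hfull, hless⟩ := hinsert F G' hF hG' hφ'
        refine ⟨insert x G', hfull, hless, v, hvF, ?_, ?_⟩
        · intro hv
          exact hvG (hcG (Finset.mem_insert_of_mem (Finset.mem_filter.2
            ⟨hvE, hzy.trans (hyle v hvF hv hvx)⟩)))
        · intro w hw
          obtain ⟨hwv, hwF⟩ := Finset.mem_erase.1 hw
          by_cases hwx : w = x
          · simp [hwx]
          · exact Finset.mem_insert_of_mem (hsubs (Finset.mem_erase.2
              ⟨hwv, Finset.mem_erase.2 ⟨hwx, hwF⟩⟩))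
      · have hmm : b = a := hinj x ψ _ _ hgood hb ha hψ
        rw [hmm] at hφ hEG
        obtain ⟨G', hG', hφ', v, hvE, hvG, hsubs⟩ := hexs _ _ hE hEG hφ
        obtain ⟨hvx, hvF⟩ := Finset.mem_erase.1 hvE
        obtain ⟨hfull, hless⟩ := hinsert F G' hF hG' hφ'
        refine ⟨insert x G', hfull, hless, v, hvF,
          fun hv => hvG (Finset.mem_erase.2 ⟨hvx, hv⟩), ?_⟩
        intro w hw
        obtain ⟨hwv, hwF⟩ := Finset.mem_erase.1 hw
        by_cases hwx : w = x
        · simp [hwx]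
        · exact Finset.mem_insert_of_mem (hsubs (Finset.mem_erase.2
            ⟨hwv, Finset.mem_erase.2 ⟨hwx, hwF⟩⟩))

end RecursiveAtomOrdering

/-! ### Contractions of building sets -/

section BuildingSets

variable {α : Type*}

theorem exists_component {B : Set (Finset α)} {I J : Finset α} (hJ : J ∈ B) (hJI : J ⊆ I) :
    ∃ C, IsComponent (restrictTo B I) C ∧ J ⊆ C := by
  have hfin : (restrictTo B I).Finite :=
    Set.Finite.subset (Finset.finite_toSet I.powerset) fun K hK =>
      Finset.mem_coe.2 (Finset.mem_powerset.2 hK.2)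
  obtain ⟨C, hJC, hC⟩ := hfin.exists_le_maximal (show J ∈ restrictTo B I from ⟨hJ, hJI⟩)
  exact ⟨C, hC, hJC⟩

section Contraction

variable [DecidableEq α] {S : Finset α} {B : Set (Finset α)} {I J C D T : Finset α}

/-- The contraction of `B` by `I`: the nonempty traces of members of `B` off `I`. -/
def contractBy (B : Set (Finset α)) (I : Finset α) : Set (Finset α) :=
  {K | K.Nonempty ∧ ∃ D ∈ B, K = D \ I}

/-- Lets the recursion go one cover up while always working with contractions of the single building
set `B`. -/
theorem contractBy_contractBy (B : Set (Finset α)) (I J : Finset α) :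
    contractBy (contractBy B I) J = contractBy B (I ∪ J) := by
  ext K
  constructor
  · rintro ⟨hK, D, ⟨-, E, hE, rfl⟩, rfl⟩
    exact ⟨hK, E, hE, by rw [sdiff_sdiff_left, Finset.sup_eq_union]⟩
  · rintro ⟨hK, D, hD, rfl⟩
    have he : D \ (I ∪ J) = (D \ I) \ J := by rw [sdiff_sdiff_left, Finset.sup_eq_union]
    exact ⟨hK, D \ I, ⟨(he ▸ hK).mono Finset.sdiff_subset, D, hD, rfl⟩, he⟩

theorem IsBuildingSet.contract (hB : IsBuildingSet S B) (I : Finset α) :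
    IsBuildingSet (S \ I) (contractBy B I) where
  subset := by
    rintro _ ⟨-, D, hD, rfl⟩
    exact Finset.sdiff_subset_sdiff (hB.subset D hD) le_rfl
  nonempty := fun _ h => h.1
  singleton_mem := by
    intro i hi
    obtain ⟨hiS, hiI⟩ := Finset.mem_sdiff.1 hi
    refine ⟨Finset.singleton_nonempty i, {i}, hB.singleton_mem i hiS, ?_⟩
    rw [Finset.sdiff_eq_self_of_disjoint]
    simpa using hiI
  union_mem := by
    rintro _ ⟨hK, D, hD, rfl⟩ _ ⟨-, E, hE, rfl⟩ hne
    refine ⟨hK.mono Finset.subset_union_left, D ∪ E, hB.union_mem D hD E hE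
      (hne.mono (Finset.inter_subset_inter Finset.sdiff_subset Finset.sdiff_subset)), ?_⟩
    rw [Finset.union_sdiff_distrib]

theorem IsBuildingSet.subset_component (hB : IsBuildingSet S B)
    (hC : IsComponent (restrictTo B I) C) (hJ : J ∈ B) (hJI : J ⊆ I) (hne : (J ∩ C).Nonempty) :
    J ⊆ C :=
  Finset.subset_union_left.trans
    (hC.2 ⟨hB.union_mem J hJ C hC.1.1 hne, Finset.union_subset hJI hC.1.2⟩
      Finset.subset_union_right)

/-- Such a `D` is a disjoint union of components of the restriction to `I`; the induction peels off
one even component at a time. -/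
theorem IsBuildingSet.even_card_of_isClosed (hB : IsBuildingSet S B) (hI : I ∈ evenPoset S B)
    (n : ℕ) : ∀ D : Finset α, D.card = n → D ⊆ I →
      (∀ J ∈ B, J ⊆ I → (J ∩ D).Nonempty → J ⊆ D) → Even D.card := by
  induction n using Nat.strong_induction_on with
  | _ n ih =>
    intro D hn hDI hcl
    rcases D.eq_empty_or_nonempty with rfl | ⟨i, hi⟩
    · simp
    have hiI := hDI hi
    obtain ⟨C, hC, hiC⟩ := exists_component (hB.singleton_mem i (hI.1 hiI))
      (Finset.singleton_subset_iff.2 hiI)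
    rw [Finset.singleton_subset_iff] at hiC
    have hCD : C ⊆ D := hcl C hC.1.1 hC.1.2 ⟨i, Finset.mem_inter.2 ⟨hiC, hi⟩⟩
    have hlt : (D \ C).card < n :=
      hn ▸ Finset.card_lt_card (Finset.sdiff_ssubset hCD ⟨i, hiC⟩)
    have h1 := ih _ hlt (D \ C) rfl (Finset.sdiff_subset.trans hDI) (by
      intro J hJ hJI hne
      have hJD := hcl J hJ hJI (hne.mono (Finset.inter_subset_inter le_rfl Finset.sdiff_subset))
      refine Finset.subset_sdiff.2 ⟨hJD, ?_⟩
      rw [Finset.disjoint_iff_inter_eq_empty]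
      by_contra hJC
      have := hB.subset_component hC hJ hJI (Finset.nonempty_iff_ne_empty.2 hJC)
      obtain ⟨j, hj⟩ := hne
      obtain ⟨hjJ, hjD⟩ := Finset.mem_inter.1 hj
      exact (Finset.mem_sdiff.1 hjD).2 (this hjJ))
    have h2 : Even C.card := Nat.not_odd_iff_even.1 (hI.2 C hC)
    rw [← Finset.card_sdiff_add_card_eq_card hCD]
    exact h1.add h2

theorem IsBuildingSet.even_card (hB : IsBuildingSet S B) (hI : I ∈ evenPoset S B) :
    Even I.card :=
  hB.even_card_of_isClosed hI _ I rfl le_rfl fun _ _ h _ => h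

/-- A member inside `I` that meets `C` lies in `C`, so `C ∩ I` is a union of components of the
restriction to `I` and has even size. -/
theorem IsBuildingSet.even_card_component_iff (hB : IsBuildingSet S B) (hI : I ∈ evenPoset S B)
    (hIJ : I ⊆ J) (hC : IsComponent (restrictTo B J) C) :
    Even C.card ↔ Even (C \ I).card := by
  have h1 : Even (C ∩ I).card := hB.even_card_of_isClosed hI _ (C ∩ I) rfl
    Finset.inter_subset_right (by
      intro K hK hKI hne
      exact Finset.subset_inter (hB.subset_component hC hK (hKI.trans hIJ)
        (hne.mono (Finset.inter_subset_inter le_rfl Finset.inter_subset_left))) hKI)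
  rw [← Finset.card_sdiff_add_card_inter C I, Nat.even_add]
  simp [h1]

theorem IsBuildingSet.exists_even_contract (hB : IsBuildingSet S B) (hI : I ∈ evenPoset S B)
    (hJ : J ∈ evenPoset S B) (hIJ : I ⊆ J) {K : Finset α} (hK : K ∈ contractBy B I)
    (hKJ : K ⊆ J) : ∃ C ∈ contractBy B I, K ⊆ C ∧ C ⊆ J ∧ Even C.card := by
  obtain ⟨hne, D, hD, rfl⟩ := hK
  have hDJ : D ⊆ J := by
    intro i hi
    by_cases hiI : i ∈ I
    · exact hIJ hiI
    · exact hKJ (Finset.mem_sdiff.2 ⟨hi, hiI⟩)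
  obtain ⟨C, hC, hDC⟩ := exists_component hD hDJ
  have hsub : D \ I ⊆ C \ I := Finset.sdiff_subset_sdiff hDC le_rfl
  exact ⟨C \ I, ⟨hne.mono hsub, C, hC.1.1, rfl⟩, hsub, Finset.sdiff_subset.trans hC.1.2,
    (hB.even_card_component_iff hI hIJ hC).1 (Nat.not_odd_iff_even.1 (hJ.2 C hC))⟩

/-- Forwards, a nonempty even member of the contraction inside the pair `T` must be `T`. Backwards,
a component of the restriction to `I ∪ T` has trace `∅` or `T` off `I`, since the member inducing
`T` is contained in any component that meets `T`. -/
theorem IsBuildingSet.union_pair_mem_iff (hB : IsBuildingSet S B) (hI : I ∈ evenPoset S B)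
    (hTS : T ⊆ S) (hT : T.card = 2) (hd : Disjoint T I) :
    I ∪ T ∈ evenPoset S B ↔ T ∈ contractBy B I := by
  have hsd : ∀ C ⊆ I ∪ T, C \ I ⊆ T := by
    intro C hC i hi
    obtain ⟨hiC, hiI⟩ := Finset.mem_sdiff.1 hi
    exact (Finset.mem_union.1 (hC hiC)).resolve_left hiI
  constructor
  · intro hJ
    obtain ⟨i, hi⟩ := Finset.card_pos.1 (by omega : 0 < T.card)
    have hiI : i ∉ I := Finset.disjoint_left.1 hd hi
    have hi' : {i} ∈ contractBy B I :=
      (hB.contract I).singleton_mem i (Finset.mem_sdiff.2 ⟨hTS hi, hiI⟩)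
    obtain ⟨C, hC, hiC, hCJ, hev⟩ := hB.exists_even_contract hI hJ Finset.subset_union_left hi'
      (Finset.singleton_subset_iff.2 (Finset.mem_union_right _ hi))
    have hCT : C ⊆ T := by
      obtain ⟨-, D, -, rfl⟩ := hC
      intro j hj
      exact (Finset.mem_union.1 (hCJ hj)).resolve_left (Finset.mem_sdiff.1 hj).2
    have hpos := Finset.card_pos.2 hC.1
    obtain ⟨m, hm⟩ := hev
    rwa [Finset.eq_of_subset_of_card_le hCT (by omega)] at hC
  · rintro ⟨-, D, hD, hTD⟩
    refine ⟨Finset.union_subset hI.1 hTS, fun C hC => ?_⟩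
    rw [Nat.not_odd_iff_even, hB.even_card_component_iff hI Finset.subset_union_left hC]
    have hCT := hsd C hC.1.2
    have hDsub : D ⊆ I ∪ T := by
      intro i hi
      by_cases hiI : i ∈ I
      · exact Finset.mem_union_left _ hiI
      · exact Finset.mem_union_right _ (hTD ▸ Finset.mem_sdiff.2 ⟨hi, hiI⟩)
    rcases (C \ I).eq_empty_or_nonempty with he | ⟨i, hi⟩
    · simp [he]
    · have hiD : i ∈ D := by
        have := hCT hi
        rw [hTD] at this
        exact (Finset.mem_sdiff.1 this).1
      have hDC : D ⊆ C := hB.subset_component hC hD hDsub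
        ⟨i, Finset.mem_inter.2 ⟨hiD, (Finset.mem_sdiff.1 hi).1⟩⟩
      have hTC : T ⊆ C \ I := hTD ▸ Finset.sdiff_subset_sdiff hDC le_rfl
      rw [Finset.Subset.antisymm hCT hTC, hT]
      exact even_two

end Contraction

variable [LinearOrder α] {S : Finset α} {B : Set (Finset α)} {I J C D T : Finset α}

theorem IsChordal.contract (hB : IsChordal B) (I : Finset α) : IsChordal (contractBy B I) := by
  rintro _ ⟨-, D, hD, rfl⟩ a ha
  refine ⟨⟨a, Finset.mem_filter.2 ⟨ha, le_rfl⟩⟩, D.filter (fun x => a ≤ x),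
    hB D hD a (Finset.mem_sdiff.1 ha).1, ?_⟩
  ext i
  simp only [Finset.mem_filter, Finset.mem_sdiff]
  tauto

/-! ### The two largest elements of a finite set -/

/-- The elements of `C` with at most one larger element in `C`. -/
def topPair (C : Finset α) : Finset α :=
  C.filter fun x => (C.filter fun y => x < y).card ≤ 1

theorem topPair_subset (C : Finset α) : topPair C ⊆ C := Finset.filter_subset _ _

/-- Here `c` is the second largest element; being a final segment is the form to which chordality
applies. -/
theorem exists_topPair_eq (hC : 2 ≤ C.card) :
    ∃ c ∈ C, (topPair C).card = 2 ∧ topPair C = C.filter fun x => c ≤ x := by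
  have hne : C.Nonempty := Finset.card_pos.1 (by omega)
  set d := C.max' hne with hd
  have hdC : d ∈ C := C.max'_mem hne
  have hne' : (C.erase d).Nonempty := by
    rw [← Finset.card_pos, Finset.card_erase_of_mem hdC]
    omega
  set c := (C.erase d).max' hne' with hc
  obtain ⟨hcd, hcC⟩ := Finset.mem_erase.1 ((C.erase d).max'_mem hne')
  rw [← hc] at hcd hcC
  have hle : ∀ x ∈ C, x ≤ d := fun x hx => C.le_max' x hx
  have hle' : ∀ x ∈ C, x ≠ d → x ≤ c := fun x hx hxd =>
    (C.erase d).le_max' x (Finset.mem_erase.2 ⟨hxd, hx⟩)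
  have hlt : c < d := lt_of_le_of_ne (hle c hcC) hcd
  have hfil : (C.filter fun x => c ≤ x) = {c, d} := by
    ext x
    simp only [Finset.mem_filter, Finset.mem_insert, Finset.mem_singleton]
    constructor
    · rintro ⟨hx, hcx⟩
      by_cases hxd : x = d
      · exact Or.inr hxd
      · exact Or.inl (le_antisymm (hle' x hx hxd) hcx)
    · rintro (rfl | rfl)
      · exact ⟨hcC, le_rfl⟩
      · exact ⟨hdC, hlt.le⟩
  have htop : topPair C = C.filter fun x => c ≤ x := by
    ext x
    simp only [topPair, Finset.mem_filter, and_congr_right_iff]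
    intro hx
    constructor
    · intro h1
      by_contra hxc
      rw [not_le] at hxc
      have : ({c, d} : Finset α) ⊆ C.filter fun y => x < y := by
        intro y hy
        rcases Finset.mem_insert.1 hy with rfl | hy
        · exact Finset.mem_filter.2 ⟨hcC, hxc⟩
        · rw [Finset.mem_singleton.1 hy]
          exact Finset.mem_filter.2 ⟨hdC, hxc.trans hlt⟩
      have := Finset.card_le_card this
      rw [Finset.card_pair hcd] at this
      omega
    · intro hcx
      refine Finset.card_le_one.2 fun y hy z hz => ?_
      obtain ⟨hy, hxy⟩ := Finset.mem_filter.1 hy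
      obtain ⟨hz, hxz⟩ := Finset.mem_filter.1 hz
      have h1 : y = d := by
        by_contra h
        exact absurd (hle' y hy h) (not_le_of_gt (hcx.trans_lt hxy))
      have h2 : z = d := by
        by_contra h
        exact absurd (hle' z hz h) (not_le_of_gt (hcx.trans_lt hxz))
      rw [h1, h2]
  exact ⟨c, hcC, by rw [htop, hfil, Finset.card_pair hcd], htop⟩

theorem IsChordal.topPair_mem (hB : IsChordal B) (hC : C ∈ B) (h2 : 2 ≤ C.card) :
    topPair C ∈ B := by
  obtain ⟨c, hc, -, he⟩ := exists_topPair_eq h2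
  exact he ▸ hB C hC c hc

theorem card_topPair (h2 : 2 ≤ C.card) : (topPair C).card = 2 := by
  obtain ⟨c, -, h, -⟩ := exists_topPair_eq h2
  exact h

/-- Removing elements can only lower the number of larger ones. This inclusion links top pairs
before and after a contraction. -/
theorem topPair_subset_union_topPair_sdiff (C T : Finset α) :
    topPair C ⊆ T ∪ topPair (C \ T) := by
  intro x hx
  obtain ⟨hxC, hx1⟩ := Finset.mem_filter.1 hx
  by_cases hxT : x ∈ T
  · exact Finset.mem_union_left _ hxT
  · refine Finset.mem_union_right _ (Finset.mem_filter.2 ⟨Finset.mem_sdiff.2 ⟨hxC, hxT⟩, ?_⟩)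
    exact (Finset.card_le_card (Finset.filter_subset_filter _ Finset.sdiff_subset)).trans hx1

theorem toColex_le_topPair {W : Finset α} (hWC : W ⊆ C) (hW : W.card = 2) :
    toColex W ≤ toColex (topPair C) := by
  have h2 : 2 ≤ C.card := hW ▸ Finset.card_le_card hWC
  obtain ⟨c, hc, hcard, he⟩ := exists_topPair_eq h2
  rw [Finset.Colex.toColex_le_toColex]
  intro a haW haT
  have hac : a < c := by
    by_contra h
    exact haT (he ▸ Finset.mem_filter.2 ⟨hWC haW, not_lt.1 h⟩)
  have hnot : ¬ topPair C ⊆ W := fun hsub =>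
    haT (Finset.eq_of_subset_of_card_le hsub (by omega) ▸ haW)
  obtain ⟨b, hb, hbW⟩ := Finset.not_subset.1 hnot
  refine ⟨b, hb, hbW, hac.le.trans ?_⟩
  rw [he] at hb
  exact (Finset.mem_filter.1 hb).2

/-! ### Orderings of the pairs in a chordal building set -/

/-- The key `ψ` separates all sets, and puts the pair of the two largest elements of any member of
`B` before every other pair of `B` in that member. -/
def IsTopFirst {Λ : Type*} [LinearOrder Λ] (B : Set (Finset α)) (ψ : Finset α → Λ) : Prop :=
  Function.Injective ψ ∧ ∀ C ∈ B, ∀ W ∈ B, W.card = 2 → W ⊆ C → ψ (topPair C) ≤ ψ W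

/-- The keys used to order pairs: an integer, and then the reversed colexicographic order. -/
abbrev PairKey (α : Type*) [LinearOrder α] : Type _ := ℕ ×ₗ (Colex (Finset α))ᵒᵈ

/-- The key of a pair `U` with first entry `n U`. -/
def pairKey (n : Finset α → ℕ) (U : Finset α) : PairKey α :=
  toLex (n U, OrderDual.toDual (toColex U))

theorem pairKey_injective (n : Finset α → ℕ) : Function.Injective (pairKey n) := by
  intro U V h
  have := congrArg (fun p => (ofLex p).2) h
  simpa [pairKey] using this

theorem isTopFirst_pairKey (n : Finset α → ℕ)
    (h : ∀ C ∈ B, ∀ W ∈ B, W.card = 2 → W ⊆ C → n (topPair C) ≤ n W) :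
    IsTopFirst B (pairKey n) := by
  refine ⟨pairKey_injective n, fun C hC W hW hcard hWC => ?_⟩
  rw [pairKey, pairKey, Prod.Lex.toLex_le_toLex]
  rcases (h C hC W hW hcard hWC).lt_or_eq with hlt | heq
  · exact Or.inl hlt
  · exact Or.inr ⟨heq, OrderDual.toDual_le_toDual.2 (toColex_le_topPair hWC hcard)⟩

/-- The new key puts the pairs lying above an earlier alternative to `T` first and breaks ties by
reversed colexicographic order. It is top-first because having an earlier alternative passes from
any pair inside a member `C` of the contraction to the top pair of `C`. -/
theorem IsTopFirst.exists_contract {Λ : Type*} [LinearOrder Λ] {ψ : Finset α → Λ}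
    (hB : IsBuildingSet S B) (hc : IsChordal B) (hψ : IsTopFirst B ψ) (hT : T ∈ B)
    (hT2 : T.card = 2) : ∃ ψ' : Finset α → PairKey α, IsTopFirst (contractBy B T) ψ' ∧
      ∀ U V, (∃ W ∈ B, W.card = 2 ∧ ψ W < ψ T ∧ W ⊆ T ∪ U) →
        (¬ ∃ W ∈ B, W.card = 2 ∧ ψ W < ψ T ∧ W ⊆ T ∪ V) → ψ' U < ψ' V := by
  classical
  set P : Finset α → Prop := fun U => ∃ W ∈ B, W.card = 2 ∧ ψ W < ψ T ∧ W ⊆ T ∪ U with hP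
  refine ⟨pairKey fun U => if P U then 0 else 1, isTopFirst_pairKey _ ?_, ?_⟩
  · intro C hC W' hW' hW'2 hW'C
    have h2 : 2 ≤ C.card := hW'2 ▸ Finset.card_le_card hW'C
    suffices h : P W' → P (topPair C) by
      by_cases h1 : P W'
      · simp [h1, h h1]
      · simp only [h1, if_false]
        split_ifs <;> omega
    rintro ⟨W, hW, hW2, hWT, hWsub⟩
    -- If `C` comes from some `D ⊇ T`, then the top pair of `D` is the earlier alternative.
    -- Otherwise `C` is itself a member of `B` disjoint from `T`; then `W` must avoid `T`, as `C ∪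
    -- W` would else be a member meeting `T` with trace `C`, and so `W ⊆ C` and the top pair of `C`
    -- serves.
    by_cases hD : ∃ D ∈ B, T ⊆ D ∧ C = D \ T
    · obtain ⟨D, hD, hTD, rfl⟩ := hD
      have hD2 : 2 ≤ D.card := hT2 ▸ Finset.card_le_card hTD
      exact ⟨topPair D, hc.topPair_mem hD hD2, card_topPair hD2,
        (hψ.2 D hD W hW hW2 (hWsub.trans (Finset.union_subset hTD
          (hW'C.trans Finset.sdiff_subset)))).trans_lt hWT,
        topPair_subset_union_topPair_sdiff D T⟩
    · have hclosed : ∀ D ∈ B, C = D \ T → (D ∩ T) = ∅ := by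
        intro D hDB hCD
        by_contra hne
        refine hD ⟨D ∪ T, hB.union_mem D hDB T hT (Finset.nonempty_iff_ne_empty.2 hne),
          Finset.subset_union_right, ?_⟩
        rw [hCD, Finset.union_sdiff_right]
      have hCB : C ∈ B ∧ Disjoint C T := by
        obtain ⟨-, D, hDB, hCD⟩ := hC
        have hdis := Finset.disjoint_iff_inter_eq_empty.2 (hclosed D hDB hCD)
        rw [Finset.sdiff_eq_self_of_disjoint hdis] at hCD
        exact hCD ▸ ⟨hDB, hdis⟩
      have hWd : Disjoint W T := by
        rw [Finset.disjoint_iff_inter_eq_empty]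
        by_contra hne
        have hne := Finset.nonempty_iff_ne_empty.2 hne
        have hmeet : (C ∩ W).Nonempty := by
          have hnot : ¬ W ⊆ T := fun hsub =>
            hWT.ne (congrArg ψ (Finset.eq_of_subset_of_card_le hsub (by omega)))
          obtain ⟨i, hi, hiT⟩ := Finset.not_subset.1 hnot
          exact ⟨i, Finset.mem_inter.2
            ⟨hW'C ((Finset.mem_union.1 (hWsub hi)).resolve_left hiT), hi⟩⟩
        have hCW := hB.union_mem C hCB.1 W hW hmeet
        have heq : C = (C ∪ W) \ T := by
          ext i
          simp only [Finset.mem_sdiff, Finset.mem_union]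
          constructor
          · exact fun hi => ⟨Or.inl hi, Finset.disjoint_left.1 hCB.2 hi⟩
          · rintro ⟨hi | hi, hiT⟩
            · exact hi
            · exact hW'C ((Finset.mem_union.1 (hWsub hi)).resolve_left hiT)
        have := hclosed _ hCW heq
        obtain ⟨i, hi⟩ := hne
        have hi' : i ∈ (C ∪ W) ∩ T := Finset.mem_inter.2
          ⟨Finset.mem_union_right _ (Finset.mem_inter.1 hi).1, (Finset.mem_inter.1 hi).2⟩
        simp [this] at hi'
      have hWC : W ⊆ C := fun i hi => hW'C ((Finset.mem_union.1 (hWsub hi)).resolve_left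
        (Finset.disjoint_left.1 hWd hi))
      exact ⟨topPair C, hc.topPair_mem hCB.1 h2, card_topPair h2,
        (hψ.2 C hCB.1 W hW hW2 hWC).trans_lt hWT, Finset.subset_union_right⟩
  · intro U V hU hV
    change P U at hU
    change ¬ P V at hV
    rw [pairKey, pairKey, Prod.Lex.toLex_lt_toLex]
    left
    simp [hU, hV]

/-- If `W` and `T` are disjoint, `W` itself is the extension. If they meet, `T ∪ W` lies in an even
member `C` inside `Y`; parity leaves at least two elements in `C \ T`, and the top pair of `C`,
which is no later than `W`, is covered by `T` and the top pair of `C \ T`. -/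
theorem IsTopFirst.exists_exchange {Λ : Type*} [LinearOrder Λ] {ψ : Finset α → Λ}
    (hB : IsBuildingSet S B) (hc : IsChordal B) (hψ : IsTopFirst B ψ) (hT : T ∈ B)
    (hT2 : T.card = 2) {W Y : Finset α} (hW : W ∈ B) (hW2 : W.card = 2) (hWT : ψ W < ψ T)
    (hTY : T ⊆ Y) (hWY : W ⊆ Y)
    (hY : ∀ K ∈ B, K ⊆ Y → ∃ C ∈ B, K ⊆ C ∧ C ⊆ Y ∧ Even C.card) :
    ∃ U ∈ contractBy B T, U.card = 2 ∧ U ⊆ Y ∧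
      ∃ W' ∈ B, W'.card = 2 ∧ ψ W' < ψ T ∧ W' ⊆ T ∪ U := by
  by_cases hd : Disjoint W T
  · refine ⟨W, ⟨hB.nonempty W hW, W, hW, (Finset.sdiff_eq_self_of_disjoint hd).symm⟩, hW2, hWY,
      W, hW, hW2, hWT, Finset.subset_union_right⟩
  · have hne : (T ∩ W).Nonempty := by
      rw [Finset.inter_comm, Finset.nonempty_iff_ne_empty, Ne,
        ← Finset.disjoint_iff_inter_eq_empty]
      exact hd
    obtain ⟨C, hC, hsub, hCY, hev⟩ := hY _ (hB.union_mem T hT W hW hne)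
      (Finset.union_subset hTY hWY)
    have hTC : T ⊆ C := Finset.subset_union_left.trans hsub
    have hWC : W ⊆ C := Finset.subset_union_right.trans hsub
    have hnot : ¬ C ⊆ T := fun h =>
      hWT.ne (congrArg ψ (Finset.eq_of_subset_of_card_le (hWC.trans h) (by omega)))
    have hpos : 0 < (C \ T).card := Finset.card_pos.2 (Finset.sdiff_nonempty.2 hnot)
    have hcard := Finset.card_sdiff_add_card_eq_card hTC
    obtain ⟨m, hm⟩ := hev
    have hC2 : 2 ≤ C.card := by omega
    have hCT2 : 2 ≤ (C \ T).card := by omega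
    have hCT : C \ T ∈ contractBy B T := ⟨Finset.card_pos.1 hpos, C, hC, rfl⟩
    exact ⟨topPair (C \ T), (hc.contract T).topPair_mem hCT hCT2, card_topPair hCT2,
      (topPair_subset _).trans (Finset.sdiff_subset.trans hCY), topPair C,
      hc.topPair_mem hC hC2, card_topPair hC2, (hψ.2 C hC W hW hW2 hWC).trans_lt hWT,
      topPair_subset_union_topPair_sdiff C T⟩

/-! ### The poset of even sets -/

theorem IsBuildingSet.top_mem_evenPoset (hB : IsBuildingSet S B) (heven : NoOddComponent B) :
    S ∈ evenPoset S B := by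
  refine ⟨le_rfl, ?_⟩
  have : restrictTo B S = B := Set.ext fun J => ⟨fun h => h.1, fun h => ⟨h, hB.subset J h⟩⟩
  rwa [this]

theorem IsBuildingSet.empty_mem_evenPoset (hB : IsBuildingSet S B) : ∅ ∈ evenPoset S B := by
  refine ⟨Finset.empty_subset S, fun C hC => ?_⟩
  have := hB.nonempty C hC.1.1
  rw [Finset.subset_empty.1 hC.1.2] at this
  simp at this

/-- The cover relation of the poset of even sets, in terms of contractions. -/
theorem IsBuildingSet.rankCover_iff (hB : IsBuildingSet S B) (hI : I ∈ evenPoset S B) :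
    RankCover (evenPoset S B) (fun I => I.card / 2) I J ↔
      I ⊆ J ∧ (J \ I).card = 2 ∧ J \ I ∈ contractBy B I := by
  have hev := hB.even_card hI
  constructor
  · rintro ⟨hJ, hlt, hr⟩
    have hsub : I ⊆ J := hlt.le
    have hevJ := hB.even_card hJ
    have hcard := Finset.card_sdiff_add_card_eq_card hsub
    obtain ⟨m, hm⟩ := hev
    obtain ⟨m', hm'⟩ := hevJ
    have h2 : (J \ I).card = 2 := by
      simp only at hr
      omega
    refine ⟨hsub, h2, (hB.union_pair_mem_iff hI (Finset.sdiff_subset.trans hJ.1) h2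
      Finset.sdiff_disjoint).1 ?_⟩
    rwa [Finset.union_sdiff_of_subset hsub]
  · rintro ⟨hsub, h2, hmem⟩
    have hJS : J \ I ⊆ S := by
      obtain ⟨-, D, hD, he⟩ := hmem
      exact he ▸ Finset.sdiff_subset.trans (hB.subset D hD)
    have hJ := (hB.union_pair_mem_iff hI hJS h2 Finset.sdiff_disjoint).2 hmem
    rw [Finset.union_sdiff_of_subset hsub] at hJ
    have hcard := Finset.card_sdiff_add_card_eq_card hsub
    refine ⟨hJ, lt_of_le_of_ne hsub ?_, ?_⟩
    · rintro rfl
      simp at h2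
    · simp only
      omega

theorem IsBuildingSet.isRanked_evenPoset (hB : IsBuildingSet S B) (hc : IsChordal B)
    (heven : NoOddComponent B) : IsRanked (evenPoset S B) (fun I => I.card / 2) S where
  top_mem := hB.top_mem_evenPoset heven
  le_top := fun _ h => h.1
  rank_lt := by
    intro I hI J hJ hlt
    have h1 := Finset.card_lt_card hlt
    obtain ⟨m, hm⟩ := hB.even_card hI
    obtain ⟨m', hm'⟩ := hB.even_card hJ
    omega
  exists_cover := by
    intro I hI J hJ hlt
    -- Any point of `J \ I` lies in an even member of the contraction inside `J`, whose top pair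
    -- gives the cover.
    obtain ⟨i, hiJ, hiI⟩ := Finset.exists_of_ssubset hlt
    obtain ⟨C, hC, hiC, hCJ, hev⟩ := hB.exists_even_contract hI hJ hlt.le
      ((hB.contract I).singleton_mem i (Finset.mem_sdiff.2 ⟨hJ.1 hiJ, hiI⟩))
      (Finset.singleton_subset_iff.2 hiJ)
    have hpos := Finset.card_pos.2 hC.1
    obtain ⟨m, hm⟩ := hev
    have h2 : 2 ≤ C.card := by omega
    have hd : Disjoint C I := by
      obtain ⟨-, D, -, rfl⟩ := hC
      exact Finset.sdiff_disjoint
    have he : (I ∪ topPair C) \ I = topPair C := by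
      rw [Finset.union_sdiff_left]
      exact Finset.sdiff_eq_self_of_disjoint (Disjoint.mono_left (topPair_subset C) hd)
    refine ⟨I ∪ topPair C, (hB.rankCover_iff hI).2 ⟨Finset.subset_union_left, ?_, ?_⟩,
      Finset.union_subset hlt.le ((topPair_subset C).trans hCJ)⟩
    · rw [he, card_topPair h2]
    · rw [he]
      exact (hc.contract I).topPair_mem hC h2

/-- The full chains of the poset of even sets have a shelling order. -/
theorem IsBuildingSet.exists_shelling_key (hB : IsBuildingSet S B) (hc : IsChordal B)
    (heven : NoOddComponent B) (k : ℕ) (hS : S.card = 2 * (k + 1)) :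
    ∃ φ : Finset (Finset α) → List (PairKey α),
      (∀ F G, IsFullChain (evenPoset S B) (fun I => I.card / 2) S ∅ F →
        IsFullChain (evenPoset S B) (fun I => I.card / 2) S ∅ G → φ F = φ G → F = G) ∧
      (∀ F G, IsFullChain (evenPoset S B) (fun I => I.card / 2) S ∅ F →
        IsFullChain (evenPoset S B) (fun I => I.card / 2) S ∅ G → φ G < φ F →
        ∃ G', IsFullChain (evenPoset S B) (fun I => I.card / 2) S ∅ G' ∧ φ G' < φ F ∧
          ∃ v ∈ F, v ∉ G ∧ F.erase v ⊆ G') := by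
  have hsd : ∀ I T : Finset α, T ∈ contractBy B I → (I ∪ T) \ I = T := by
    rintro I _ ⟨-, D, -, rfl⟩
    rw [Finset.union_sdiff_left]
    exact Finset.sdiff_eq_self_of_disjoint Finset.sdiff_disjoint
  have hcov : ∀ I T : Finset α, I ∈ evenPoset S B → T ∈ contractBy B I → T.card = 2 →
      RankCover (evenPoset S B) (fun I => I.card / 2) I (I ∪ T) := by
    intro I T hI hT hT2
    rw [hB.rankCover_iff hI, hsd I T hT]
    exact ⟨Finset.subset_union_left, hT2, hT⟩
  obtain ⟨φ, h1, h2, -⟩ := (hB.isRanked_evenPoset hc heven).exists_shelling_key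
    -- The invariant of the recursion: the covers `J` of `I` are ordered by a top-first key of the
    -- added pair `J \ I`.
    (fun I ψ => I ∈ evenPoset S B ∧ ∃ χ : Finset α → PairKey α,
      IsTopFirst (contractBy B I) χ ∧ ψ = fun J => χ (J \ I))
    (by
      rintro I _ J J' ⟨hI, χ, hχ, rfl⟩ hJ hJ' he
      have h := hχ.1 he
      rw [← Finset.union_sdiff_of_subset hJ.2.1.le, h, Finset.union_sdiff_of_subset hJ'.2.1.le])
    (by
      rintro I _ J hI ⟨-, χ, hχ, rfl⟩ hJ
      obtain ⟨hIJ, hT2, hT⟩ := (hB.rankCover_iff hI).1 hJ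
      obtain ⟨χ', hχ', hfirst⟩ := hχ.exists_contract (hB.contract I) (hc.contract I) hT hT2
      rw [contractBy_contractBy, Finset.union_sdiff_of_subset hIJ] at hχ'
      refine ⟨fun K => χ' (K \ J), ⟨hJ.1, χ', hχ', rfl⟩, ?_⟩
      have hiff : ∀ K, RankCover (evenPoset S B) (fun I => I.card / 2) J K →
          ((∃ L, RankCover (evenPoset S B) (fun I => I.card / 2) I L ∧
            χ (L \ I) < χ (J \ I) ∧ L < K) ↔
          ∃ W ∈ contractBy B I, W.card = 2 ∧ χ W < χ (J \ I) ∧ W ⊆ J \ I ∪ K \ J) := by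
        intro K hK
        have hJK : J ⊆ K := hK.2.1.le
        have hKI : J \ I ∪ K \ J = K \ I := by
          ext i
          have := @hJK i
          have := @hIJ i
          simp only [Finset.mem_union, Finset.mem_sdiff]
          tauto
        rw [hKI]
        constructor
        · rintro ⟨L, hL, hlt, hLK⟩
          obtain ⟨-, hL2, hLm⟩ := (hB.rankCover_iff hI).1 hL
          exact ⟨L \ I, hLm, hL2, hlt, Finset.sdiff_subset_sdiff hLK.le le_rfl⟩
        · rintro ⟨W, hW, hW2, hlt, hWK⟩
          have hL := hcov I W hI hW hW2
          refine ⟨I ∪ W, hL, ?_, lt_of_le_of_ne (Finset.union_subset (hIJ.trans hJK)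
            (hWK.trans Finset.sdiff_subset)) ?_⟩
          · rwa [hsd I W hW]
          · intro he
            have h3 := hL.2.2
            have h4 := hK.2.2
            have h5 := hJ.2.2
            rw [he] at h3
            omega
      intro K L hK hL hKe hLe
      exact hfirst _ _ ((hiff K hK).1 hKe) fun h => hLe ((hiff L hL).2 h))
    (by
      rintro I _ J L Y hI ⟨-, χ, hχ, rfl⟩ hJ hL hlt hY hJY hLY
      obtain ⟨hIJ, hT2, hT⟩ := (hB.rankCover_iff hI).1 hJ
      obtain ⟨hIL, hW2, hW⟩ := (hB.rankCover_iff hI).1 hL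
      obtain ⟨U, hU, hU2, hUY, W', hW', hW'2, hlt', hsub⟩ :=
        hχ.exists_exchange (hB.contract I) (hc.contract I) hT hT2 hW hW2 hlt
          (Finset.sdiff_subset.trans hJY.le) (Finset.sdiff_subset.trans hLY.le)
          (fun K hK hKY => hB.exists_even_contract hI hY (hIJ.trans hJY.le) hK hKY)
      rw [contractBy_contractBy, Finset.union_sdiff_of_subset hIJ] at hU
      have hcJ := hcov J U hJ.1 hU hU2
      have hcI := hcov I W' hI hW' hW'2
      refine ⟨J ∪ U, Finset.union_subset hJY.le hUY, hcJ, I ∪ W', hcI, ?_,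
        lt_of_le_of_ne ?_ ?_⟩
      · simp only
        rwa [hsd I W' hW']
      · refine Finset.union_subset (hIJ.trans Finset.subset_union_left) (hsub.trans ?_)
        exact Finset.union_subset_union Finset.sdiff_subset le_rfl
      · intro he
        have h3 := hcI.2.2
        have h4 := hcJ.2.2
        have h5 := hJ.2.2
        rw [he] at h3
        omega)
    k ∅ (fun J => pairKey (fun _ => 0) (J \ ∅)) hB.empty_mem_evenPoset
    (by simp [hS])
    ⟨hB.empty_mem_evenPoset, pairKey fun _ => 0,
      isTopFirst_pairKey _ fun _ _ _ _ _ _ => le_rfl, rfl⟩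
  exact ⟨φ, h1, h2⟩

end BuildingSets

/-! ### Shellability of the order complex -/

/-- List the facets by increasing key. By exchange, a face shared with an earlier facet misses some
vertex `v` for which the facet minus `v` is shared too, so the maximal shared faces have codimension
one. -/
theorem isShellable_of_key {V Λ : Type*} [DecidableEq V] [LinearOrder Λ]
    (K : PreAbstractSimplicialComplex V) (hfin : K.faces.Finite) (n : ℕ)
    (hcard : ∀ s ∈ facetSet K, s.card = n) (φ : Finset V → Λ)
    (hinj : Set.InjOn φ (facetSet K))
    (hex : ∀ s ∈ facetSet K, ∀ u ∈ facetSet K, φ u < φ s →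
      ∃ s' ∈ facetSet K, φ s' < φ s ∧ ∃ v ∈ s, v ∉ u ∧ s.erase v ⊆ s') : IsShellable K := by
  have hffin : (facetSet K).Finite := hfin.subset fun s hs => hs.1
  set T : Finset Λ := hffin.toFinset.image φ
  set e : Fin T.card ↪o Λ := T.orderEmbOfFin rfl with he
  have hmem : ∀ l, l ∈ T ↔ ∃ s ∈ facetSet K, φ s = l := fun l => by simp [T]
  have hex' : ∀ j, ∃ s ∈ facetSet K, φ s = e j := fun j =>
    (hmem _).1 (T.orderEmbOfFin_mem rfl j)
  choose F hF hφF using hex'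
  have hsurj : ∀ s ∈ facetSet K, ∃ j, F j = s := by
    intro s hs
    have hr : φ s ∈ Set.range e := by
      rw [he, Finset.range_orderEmbOfFin]
      exact Finset.mem_coe.2 ((hmem _).2 ⟨s, hs, rfl⟩)
    obtain ⟨j, hj⟩ := hr
    exact ⟨j, hinj (hF j) hs ((hφF j).trans hj)⟩
  refine ⟨hfin, n, hcard, T.card, F, ?_, ?_, ?_⟩
  · intro i j h
    exact e.injective (by rw [← hφF, ← hφF, h])
  · ext s
    constructor
    · rintro ⟨j, rfl⟩
      exact hF j
    · exact hsurj s
  · rintro j _ t ⟨⟨htj, i, hij, hti⟩, hmax⟩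
    obtain ⟨s', hs', hφ, v, hv, hvi, hsub⟩ := hex _ (hF j) _ (hF i)
      (by rw [hφF, hφF]; exact e.lt_iff_lt.2 hij)
    obtain ⟨l, rfl⟩ := hsurj s' hs'
    have hl : l < j := by
      rwa [hφF, hφF, e.lt_iff_lt] at hφ
    have hle : t ⊆ (F j).erase v := fun w hw =>
      Finset.mem_erase.2 ⟨fun h => hvi (h ▸ hti hw), htj hw⟩
    have hge := hmax (y := (F j).erase v) ⟨Finset.erase_subset _ _, l, hl, hsub⟩ hle
    rw [Finset.Subset.antisymm hle hge, Finset.card_erase_add_one hv, hcard _ (hF j)]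

section OrderComplex

variable {α : Type*} [LinearOrder α] {S : Finset α} {B : Set (Finset α)}

/-- A chain of the proper part, together with the empty set. -/
def extendChain (s : Finset (properPart S B)) : Finset (Finset α) :=
  insert ∅ (s.map (Function.Embedding.subtype _))

theorem mem_extendChain {s : Finset (properPart S B)} {I : Finset α} :
    I ∈ extendChain s ↔ I = ∅ ∨ ∃ h : I ∈ properPart S B, ⟨I, h⟩ ∈ s := by
  simp [extendChain]

theorem val_mem_extendChain {s : Finset (properPart S B)} {I : properPart S B} :
    I.1 ∈ extendChain s ↔ I ∈ s := by
  refine mem_extendChain.trans ⟨?_, ?_⟩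
  · rintro (h | ⟨_, h⟩)
    · exact absurd (Or.inl h) I.2.2
    · exact h
  · exact fun h => Or.inr ⟨I.2, h⟩

theorem card_extendChain (s : Finset (properPart S B)) :
    (extendChain s).card = s.card + 1 := by
  rw [extendChain, Finset.card_insert_of_notMem, Finset.card_map]
  intro h
  obtain ⟨I, -, hI⟩ := Finset.mem_map.1 h
  exact I.2.2 (Or.inl hI)

theorem extendChain_injective :
    Function.Injective (extendChain : Finset (properPart S B) → Finset (Finset α)) := by
  intro s u h
  ext I
  rw [← val_mem_extendChain, h, val_mem_extendChain]

theorem isChain_extendChain {s : Finset (properPart S B)}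
    (hs : IsChain (fun x y => x ≤ y) (s : Set (properPart S B))) :
    IsChain (fun y z => y ≤ z) (extendChain s : Set (Finset α)) := by
  rw [extendChain, Finset.coe_insert, Finset.coe_map]
  refine IsChain.insert ?_ fun y _ _ => Or.inl (Finset.empty_subset y)
  rintro _ ⟨I, hI, rfl⟩ _ ⟨J, hJ, rfl⟩ hne
  exact hs hI hJ fun h => hne (congrArg _ h)

theorem bounds_extendChain (hB : IsBuildingSet S B) (hne : S.Nonempty)
    (s : Finset (properPart S B)) :
    ∀ I ∈ extendChain s, I ∈ evenPoset S B ∧ ∅ ≤ I ∧ I < S := by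
  intro I hI
  rcases mem_extendChain.1 hI with rfl | ⟨h, -⟩
  · exact ⟨hB.empty_mem_evenPoset, le_rfl, Finset.empty_ssubset.2 hne⟩
  · exact ⟨h.1, Finset.empty_subset I, lt_of_le_of_ne h.1.1 fun he => h.2 (by simp [he])⟩

theorem IsFullChain.exists_extendChain {r : Finset α → ℕ} {F : Finset (Finset α)}
    (hF : IsFullChain (evenPoset S B) r S ∅ F) :
    ∃ s : Finset (properPart S B), extendChain s = F ∧
      IsChain (fun x y => x ≤ y) (s : Set (properPart S B)) := by
  classical
  refine ⟨F.subtype (· ∈ properPart S B), ?_, ?_⟩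
  · ext I
    rw [mem_extendChain]
    constructor
    · rintro (rfl | ⟨h, hI⟩)
      · exact hF.mem
      · simpa using hI
    · intro hI
      by_cases h : I = ∅
      · exact Or.inl h
      · have hb := hF.bounds I hI
        have hp : I ∈ properPart S B := ⟨hb.1, by
          rintro (h' | h')
          · exact h h'
          · exact hb.2.2.ne h'⟩
        exact Or.inr ⟨hp, by simpa using hI⟩
  · intro I hI J hJ hne
    have hI' : I.1 ∈ F := by simpa using hI
    have hJ' : J.1 ∈ F := by simpa using hJ
    exact hF.chain hI' hJ' fun h => hne (Subtype.ext h)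

/-- Adjoining `∅` identifies chains of the proper part with chains of `[∅, S)` through `∅`; by
gradedness the maximal ones meet every rank. -/
theorem IsBuildingSet.mem_facetSet_iff (hB : IsBuildingSet S B) (hc : IsChordal B)
    (heven : NoOddComponent B) (k : ℕ) (hS : S.card = 2 * (k + 2))
    (s : Finset (properPart S B)) : s ∈ facetSet (orderComplex (properPart S B)) ↔
      IsFullChain (evenPoset S B) (fun I => I.card / 2) S ∅ (extendChain s) := by
  have hr := hB.isRanked_evenPoset hc heven
  have hne : S.Nonempty := Finset.card_pos.1 (by omega)
  constructor
  · rintro ⟨⟨-, hch⟩, hmax⟩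
    obtain ⟨F, hsF, hF⟩ := hr.exists_fullChain (k + 1) ∅ (extendChain s) hB.empty_mem_evenPoset
      (by simp [hS]) (bounds_extendChain hB hne s) (isChain_extendChain hch)
    obtain ⟨u, rfl, hu⟩ := hF.exists_extendChain
    have hcard := hF.card
    rw [card_extendChain] at hcard
    simp only [Finset.card_empty, hS] at hcard
    have hsu : s ⊆ u := fun I hI => val_mem_extendChain.1 (hsF (val_mem_extendChain.2 hI))
    have hus := hmax (y := u) ⟨Finset.card_pos.1 (by omega), hu⟩ hsu
    rwa [Finset.Subset.antisymm hsu hus]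
  · intro hF
    have hcard := hF.card
    rw [card_extendChain] at hcard
    simp only [Finset.card_empty, hS] at hcard
    obtain ⟨u, hu, huch⟩ := hF.exists_extendChain
    rw [extendChain_injective hu] at huch
    refine ⟨⟨Finset.card_pos.1 (by omega), huch⟩, ?_⟩
    rintro t ⟨-, htch⟩ hst
    have hle := hr.card_le (isChain_extendChain htch) (bounds_extendChain hB hne t)
      hB.empty_mem_evenPoset
    rw [card_extendChain] at hle
    simp only [Finset.card_empty, hS] at hle
    exact (Finset.eq_of_subset_of_card_le hst (by omega)).symm.subset

theorem IsBuildingSet.isShellable_orderComplex (hB : IsBuildingSet S B) (hc : IsChordal B)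
    (heven : NoOddComponent B) (k : ℕ) (hS : S.card = 2 * k) :
    IsShellable (orderComplex (properPart S B)) := by
  have hfin : (orderComplex (properPart S B)).faces.Finite := Set.toFinite _
  -- With at most two elements in `S` the proper part is empty, so there are no facets and the size
  -- `0` records dimension `-1`.
  by_cases hk : k < 2
  · have hempty : ∀ s, s ∉ (orderComplex (properPart S B)).faces := by
      rintro s ⟨⟨⟨I, hI, hI'⟩, -⟩, -⟩
      obtain ⟨l, hl⟩ := hB.even_card hI
      have hpos : 0 < I.card :=
        Finset.card_pos.2 (Finset.nonempty_iff_ne_empty.2 fun h => hI' (Or.inl h))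
      have hlt : I.card < S.card :=
        Finset.card_lt_card (lt_of_le_of_ne hI.1 fun h => hI' (Or.inr h))
      omega
    have hf : ∀ s, s ∉ facetSet (orderComplex (properPart S B)) := fun s hs => hempty s hs.1
    exact isShellable_of_key _ hfin 0 (fun s hs => absurd hs (hf s)) (fun _ => 0)
      (fun s hs => absurd hs (hf s)) (fun s hs => absurd hs (hf s))
  · obtain ⟨m, rfl⟩ : ∃ m, k = m + 2 := ⟨k - 2, by omega⟩
    have hmem := hB.mem_facetSet_iff hc heven m hS
    obtain ⟨φ, h1, h2⟩ := hB.exists_shelling_key hc heven (m + 1) hS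
    refine isShellable_of_key _ hfin (m + 1) ?_ (fun s => φ (extendChain s)) ?_ ?_
    · intro s hs
      have hcard := ((hmem s).1 hs).card
      rw [card_extendChain] at hcard
      simp only [Finset.card_empty, hS] at hcard
      omega
    · intro s hs u hu he
      exact extendChain_injective (h1 _ _ ((hmem s).1 hs) ((hmem u).1 hu) he)
    · intro s hs u hu hlt
      obtain ⟨G', hG', hφ, v, hv, hvu, hsub⟩ := h2 _ _ ((hmem s).1 hs) ((hmem u).1 hu) hlt
      obtain ⟨s', rfl, -⟩ := hG'.exists_extendChain
      rcases mem_extendChain.1 hv with rfl | ⟨hvp, hvs⟩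
      · exact absurd (mem_extendChain.2 (Or.inl rfl)) hvu
      refine ⟨s', (hmem s').2 hG', hφ, ⟨v, hvp⟩, hvs,
        fun h => hvu (mem_extendChain.2 (Or.inr ⟨hvp, h⟩)), ?_⟩
      intro w hw
      obtain ⟨hwv, hws⟩ := Finset.mem_erase.1 hw
      exact val_mem_extendChain.1 (hsub (Finset.mem_erase.2
        ⟨fun h => hwv (Subtype.ext h), val_mem_extendChain.2 hws⟩))

theorem IsBuildingSet.exists_facet (hB : IsBuildingSet S B) (hc : IsChordal B)
    (heven : NoOddComponent B) (k : ℕ) (hS : S.card = 2 * (k + 2)) :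
    ∃ s ∈ facetSet (orderComplex (properPart S B)), s.card = k + 1 := by
  obtain ⟨F, -, hF⟩ := (hB.isRanked_evenPoset hc heven).exists_fullChain (k + 1) ∅ ∅
    hB.empty_mem_evenPoset (by simp [hS]) (by simp) (by simp)
  obtain ⟨s, rfl, -⟩ := hF.exists_extendChain
  have hcard := hF.card
  rw [card_extendChain] at hcard
  simp only [Finset.card_empty, hS] at hcard
  exact ⟨s, (hB.mem_facetSet_iff hc heven k hS s).2 hF, by omega⟩

end OrderComplex

/-! ### Collapsing a contractible subspace -/

section Collapse

open unitInterval

variable {X Y : Type*} [TopologicalSpace X] [TopologicalSpace Y]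

/-- A quotient map that collapses `A` to a point is a homotopy equivalence, if the identity is
homotopic, through maps preserving `A`, to a map that is constant on `A`. -/
theorem nonempty_homotopyEquiv_of_collapse [CompactSpace X] [T2Space Y] {A : Set X}
    (f : C(X, Y)) (hsurj : Function.Surjective f) (hconst : ∀ x ∈ A, ∀ y ∈ A, f x = f y)
    (hfib : ∀ x y, f x = f y → x = y ∨ (x ∈ A ∧ y ∈ A)) (H : C(I × X, X))
    (H0 : ∀ x, H (0, x) = x) (HA : ∀ t, ∀ x ∈ A, H (t, x) ∈ A)
    (H1 : ∀ x ∈ A, ∀ y ∈ A, H (1, x) = H (1, y)) : Nonempty (X ≃ₕ Y) := by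
  have hq : Topology.IsQuotientMap f :=
    f.continuous.isClosedMap.isQuotientMap f.continuous hsurj
  let F : C(I × X, I × Y) := (ContinuousMap.id I).prodMap f
  -- Compactness makes `id × f` a quotient map as well, so the homotopy on `X` descends to `Y`.
  have hF : Topology.IsQuotientMap F :=
    F.continuous.isClosedMap.isQuotientMap F.continuous
      (Function.Surjective.prodMap Function.surjective_id hsurj)
  let G : C(X, X) := ⟨fun x => H (1, x), by fun_prop⟩
  have hG : Function.FactorsThrough G f := by
    intro x y hxy
    rcases hfib x y hxy with rfl | ⟨hx, hy⟩
    · rfl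
    · exact H1 x hx y hy
  have hK : Function.FactorsThrough (f.comp H) F := by
    rintro ⟨t, x⟩ ⟨t', y⟩ hxy
    obtain ⟨rfl, hxy'⟩ : t = t' ∧ f x = f y := Prod.mk.inj hxy
    rcases hfib x y hxy' with rfl | ⟨hx, hy⟩
    · rfl
    · exact hconst _ (HA t x hx) _ (HA t y hy)
  let g : C(Y, X) := hq.lift G hG
  let K : C(I × Y, Y) := hF.lift (f.comp H) hK
  have hg : ∀ x, g (f x) = H (1, x) := fun x => congrArg (fun h => h x) (hq.lift_comp G hG)
  have hKF : ∀ t x, K (t, f x) = f (H (t, x)) := fun t x =>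
    congrArg (fun h => h (t, x)) (hF.lift_comp (f.comp H) hK)
  refine ⟨⟨f, g, ContinuousMap.Homotopic.symm ⟨⟨H, ?_, ?_⟩⟩,
    ContinuousMap.Homotopic.symm ⟨⟨K, ?_, ?_⟩⟩⟩⟩
  · exact H0
  · exact fun x => (hg x).symm
  · intro y
    obtain ⟨x, rfl⟩ := hsurj y
    exact (hKF 0 x).trans (congrArg f (H0 x))
  · intro y
    obtain ⟨x, rfl⟩ := hsurj y
    exact (hKF 1 x).trans (congrArg f (hg x).symm)

/-- The homotopy extension property for a contractible subspace with a neighbourhood that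
deforms into it. -/
theorem exists_homotopy_const_on {A : Set X} [ContractibleSpace A] (u : C(X, ℝ))
    (hu : ∀ x ∈ A, u x = 0) (D : C(I × X, X)) (D0 : ∀ x, D (0, x) = x)
    (DA : ∀ t, ∀ x ∈ A, D (t, x) = x) (D1 : ∀ x, u x ≤ 1 / 2 → D (1, x) ∈ A) :
    ∃ H : C(I × X, X), (∀ x, H (0, x) = x) ∧ (∀ t, ∀ x ∈ A, H (t, x) ∈ A) ∧
      ∀ x ∈ A, ∀ y ∈ A, H (1, x) = H (1, y) := by
  classical
  obtain ⟨p, ⟨h⟩⟩ := id_nullhomotopic A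
  let hh : I × X → X := fun q => if hx : q.2 ∈ A then (h (q.1, ⟨q.2, hx⟩) : A) else q.2
  have hhA : ∀ t x, (hx : x ∈ A) → hh (t, x) = (h (t, ⟨x, hx⟩) : A) := by
    intro t x hx
    simp [hh, hx]
  have hhc : ContinuousOn hh (Set.univ ×ˢ A) := by
    rw [continuousOn_iff_continuous_domRestrict]
    have : (Set.univ ×ˢ A).domRestrict hh =
        fun q : (Set.univ ×ˢ A : Set (I × X)) => ((h (q.1.1, ⟨q.1.2, q.2.2⟩) : A) : X) := by
      ext q
      exact hhA q.1.1 q.1.2 q.2.2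
    rw [this]
    fun_prop
  -- After `D` has pushed `{u ≤ 1/2}` into `A`, the contraction of `A` runs at a damped speed: full
  -- time where `u = 0`, none where `u = 1/2`, so that it glues with the map `D (1, ·)` outside.
  let τ : I × X → I := fun q => Set.projIcc 0 1 zero_le_one ((q.1 : ℝ) * (1 - 2 * u q.2))
  have hτ : Continuous τ := by
    refine continuous_projIcc.comp ?_
    fun_prop
  let G : I × X → X := fun q =>
    if u q.2 ≤ 1 / 2 then hh (τ q, D (1, q.2)) else D (1, q.2)
  have hG1 : ∀ q, u q.2 ≤ 1 / 2 → G q = hh (τ q, D (1, q.2)) := fun q hq => if_pos hq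
  have hh0 : ∀ x ∈ A, hh (0, x) = x := by
    intro x hx
    rw [hhA 0 x hx]
    simp
  have hG2 : ∀ q, 1 / 2 ≤ u q.2 → G q = D (1, q.2) := by
    intro q hq
    rcases hq.eq_or_lt with he | hlt
    · have hτ0 : τ q = 0 := by
        simp only [τ, ← he]
        norm_num
      rw [hG1 q he.ge, hτ0, hh0 _ (D1 _ he.ge)]
    · exact if_neg (not_le.2 hlt)
  have hGc : Continuous G := by
    rw [← continuousOn_univ]
    have hcover : (Set.univ : Set (I × X)) = {q | u q.2 ≤ 1 / 2} ∪ {q | 1 / 2 ≤ u q.2} := by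
      ext q
      simpa using le_total _ _
    rw [hcover]
    refine ContinuousOn.union_of_isClosed ?_ ?_ ?_ ?_
    · refine ContinuousOn.congr (f := fun q => hh (τ q, D (1, q.2))) ?_ fun q hq => hG1 q hq
      refine hhc.comp (Continuous.continuousOn (by fun_prop)) ?_
      intro q hq
      exact ⟨Set.mem_univ _, D1 _ hq⟩
    · exact ContinuousOn.congr (f := fun q => D (1, q.2))
        (Continuous.continuousOn (by fun_prop)) fun q hq => hG2 q hq
    · exact isClosed_le (by fun_prop) (by fun_prop)
    · exact isClosed_le (by fun_prop) (by fun_prop)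
  have hG0 : ∀ x, G (0, x) = D (1, x) := by
    intro x
    rcases le_total (u x) (1 / 2) with hx | hx
    · have hτ0 : τ (0, x) = 0 := by simp [τ]
      rw [hG1 _ hx, hτ0, hh0 _ (D1 _ hx)]
    · exact hG2 (0, x) hx
  have hGA : ∀ t x, (hx : x ∈ A) → G (t, x) = (h (t, ⟨x, hx⟩) : A) := by
    intro t x hx
    have hux : u x = 0 := hu x hx
    have hτt : τ (t, x) = t := by
      simp only [τ, hux]
      simp
    rw [hG1 (t, x) (by simp [hux]), hτt]
    simp only
    rw [DA 1 x hx, hhA t x hx]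
  let d1 : C(X, X) := ⟨fun x => D (1, x), by fun_prop⟩
  let g1 : C(X, X) := ⟨fun x => G (1, x), by fun_prop⟩
  let K1 : ContinuousMap.Homotopy (ContinuousMap.id X) d1 := ⟨D, D0, fun _ => rfl⟩
  let K2 : ContinuousMap.Homotopy d1 g1 := ⟨⟨G, hGc⟩, hG0, fun _ => rfl⟩
  refine ⟨(K1.trans K2).toContinuousMap, fun x => (K1.trans K2).map_zero_left x, ?_, ?_⟩
  · intro t x hx
    change (K1.trans K2) (t, x) ∈ A
    rw [ContinuousMap.Homotopy.trans_apply]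
    split_ifs
    · change D (_, x) ∈ A
      rw [DA _ x hx]
      exact hx
    · change G (_, x) ∈ A
      rw [hGA _ x hx]
      exact Subtype.coe_prop _
  · have hone : ∀ x ∈ A, (K1.trans K2) (1, x) = p := by
      intro x hx
      rw [ContinuousMap.Homotopy.apply_one]
      change G (1, x) = p
      rw [hGA 1 x hx, ContinuousMap.Homotopy.apply_one]
      rfl
    exact fun x hx y hy => (hone x hx).trans (hone y hy).symm

/-- A space that deformation retracts onto a contractible subspace is contractible. -/
theorem contractibleSpace_of_deformation {A Z : Set X} (hAZ : A ⊆ Z) (P : I × X → X)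
    (hP : Continuous P) (P0 : ∀ x ∈ Z, P (0, x) = x) (PZ : ∀ t, ∀ x ∈ Z, P (t, x) ∈ Z)
    (P1 : ∀ x ∈ Z, P (1, x) ∈ A) (PA : ∀ x ∈ A, P (1, x) = x) [ContractibleSpace A] :
    ContractibleSpace Z := by
  let ι : C(A, Z) := ⟨Set.inclusion hAZ, continuous_inclusion hAZ⟩
  let ρ : C(Z, A) := ⟨fun x => ⟨P (1, x), P1 x x.2⟩, by fun_prop⟩
  let H : C(I × Z, Z) := ⟨fun q => ⟨P (q.1, q.2), PZ q.1 q.2 q.2.2⟩, by fun_prop⟩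
  have e : Z ≃ₕ A := by
    refine ⟨ρ, ι, ContinuousMap.Homotopic.symm ⟨⟨H, ?_, ?_⟩⟩, ?_⟩
    · exact fun x => Subtype.ext (P0 x x.2)
    · exact fun x => rfl
    · have : ρ.comp ι = ContinuousMap.id A := by
        ext x
        exact PA x x.2
      rw [this]
  exact e.contractibleSpace

/-- Extending a homeomorphism between open sets by a constant. -/
theorem continuous_extend_const [T2Space X] [CompactSpace Y] [T2Space Y] {U : Set X}
    (hU : IsOpen U) (y₀ : Y) (e : U ≃ₜ ({y₀}ᶜ : Set Y)) {c : X → Y}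
    (hc : ∀ x (hx : x ∈ U), c x = (e ⟨x, hx⟩ : ({y₀}ᶜ : Set Y))) (hc' : ∀ x ∉ U, c x = y₀) :
    Continuous c := by
  have key : ∀ Z : Set Y, y₀ ∉ Z → c ⁻¹' Z =
      (fun y : ({y₀}ᶜ : Set Y) => ((e.symm y : U) : X)) '' (Subtype.val ⁻¹' Z) := by
    intro Z hZ
    ext x
    constructor
    · intro hx
      by_cases hxU : x ∈ U
      · refine ⟨e ⟨x, hxU⟩, ?_, by simp⟩
        have : c x ∈ Z := hx
        rwa [hc x hxU] at this
      · exact absurd (hc' x hxU ▸ hx : y₀ ∈ Z) hZ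
    · rintro ⟨y, hy, rfl⟩
      change c _ ∈ Z
      rw [hc _ (e.symm y).2]
      simpa using hy
  refine continuous_iff_isClosed.2 fun Z hZ => ?_
  -- As for a one-point compactification: a closed set containing `y₀` is treated through its open
  -- complement, one avoiding `y₀` through compactness.
  by_cases h0 : y₀ ∈ Z
  · have hop : IsOpen (c ⁻¹' Zᶜ) := by
      rw [key Zᶜ (by simpa using h0), ← Set.image_image (g := Subtype.val) (f := e.symm)]
      refine hU.isOpenMap_subtype_val _ (e.symm.isOpenMap _ ?_)
      exact hZ.isOpen_compl.preimage continuous_subtype_val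
    exact ⟨by simpa using hop⟩
  · rw [key Z h0]
    refine (IsCompact.image ?_ (by fun_prop)).isClosed
    refine Topology.IsInducing.subtypeVal.isCompact_preimage_iff ?_ |>.2 hZ.isCompact
    rintro y hy
    exact ⟨⟨y, fun h => h0 (h ▸ hy)⟩, rfl⟩

end Collapse

/-! ### Bouquets of spheres -/

section Bouquet

variable {n d : ℕ}

/-- The map from the bouquet to the product of its spheres. -/
noncomputable def bouquetToPi (n d : ℕ) : sphereBouquet n d → (Fin n → unitSphere d) :=
  Quotient.lift (Sum.elim (fun _ _ => sphereBase d)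
      (fun q => Function.update (fun _ => sphereBase d) q.1 q.2)) <| by
    have hb : ∀ p : Unit ⊕ (Σ _ : Fin n, unitSphere d),
        (p = Sum.inl () ∨ ∃ i, p = Sum.inr ⟨i, sphereBase d⟩) →
        Sum.elim (fun _ _ => sphereBase d)
          (fun q : Σ _ : Fin n, unitSphere d => Function.update (fun _ => sphereBase d) q.1 q.2) p
          = fun _ => sphereBase d := by
      rintro p (rfl | ⟨i, rfl⟩)
      · rfl
      · exact Function.update_eq_self i _
    rintro p q (rfl | ⟨hp, hq⟩)
    · rfl
    · rw [hb p hp, hb q hq]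

theorem bouquetToPi_inl : bouquetToPi n d (Quotient.mk _ (Sum.inl ())) = fun _ => sphereBase d :=
  rfl

theorem bouquetToPi_inr (i : Fin n) (y : unitSphere d) :
    bouquetToPi n d (Quotient.mk _ (Sum.inr ⟨i, y⟩)) =
      Function.update (fun _ => sphereBase d) i y :=
  rfl

theorem continuous_bouquetToPi : Continuous (bouquetToPi n d) := by
  refine Continuous.quotient_lift ?_ _
  refine continuous_const.sumElim (continuous_sigma fun i => ?_)
  exact continuous_const.update i continuous_id

theorem bouquetToPi_injective : Function.Injective (bouquetToPi n d) := by
  have hinl : ∀ i (y : unitSphere d),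
      (fun _ => sphereBase d) = Function.update (fun _ : Fin n => sphereBase d) i y →
      y = sphereBase d := by
    intro i y h
    have := congrFun h i
    simpa using this.symm
  rintro ⟨⟨⟩ | ⟨i, y⟩⟩ ⟨⟨⟩ | ⟨j, z⟩⟩ h
  · rfl
  · have hz := hinl j z h
    subst hz
    exact Quotient.sound (Or.inr ⟨Or.inl rfl, Or.inr ⟨j, rfl⟩⟩)
  · have hy := hinl i y h.symm
    subst hy
    exact Quotient.sound (Or.inr ⟨Or.inr ⟨i, rfl⟩, Or.inl rfl⟩)
  · have h : Function.update (fun _ : Fin n => sphereBase d) i y =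
      Function.update (fun _ => sphereBase d) j z := h
    by_cases hij : i = j
    · subst hij
      have := congrFun h i
      simp only [Function.update_self] at this
      rw [this]
    · have hi := congrFun h i
      have hj := congrFun h j
      rw [Function.update_self, Function.update_of_ne hij] at hi
      rw [Function.update_self, Function.update_of_ne (Ne.symm hij)] at hj
      subst hi
      rw [← hj]
      exact Quotient.sound (Or.inr ⟨Or.inr ⟨i, rfl⟩, Or.inr ⟨j, rfl⟩⟩)

/-- Needed so that a continuous surjection from a compact space to the bouquet is a quotient map. -/
instance : T2Space (sphereBouquet n d) :=
  T2Space.of_injective_continuous bouquetToPi_injective continuous_bouquetToPi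

/-- Maps to the spheres of a bouquet, of which at most one is off the base point at every point,
combine to a map to the bouquet. -/
theorem exists_map_to_bouquet {X : Type*} [TopologicalSpace X] (c : Fin n → X → unitSphere d)
    (hc : ∀ i, Continuous (c i))
    (hone : ∀ x i j, c i x ≠ sphereBase d → c j x ≠ sphereBase d → i = j)
    (hbase : ∃ x, ∀ i, c i x = sphereBase d)
    (hsurj : ∀ i y, y ≠ sphereBase d → ∃ x, c i x = y) :
    ∃ f : C(X, sphereBouquet n d), Function.Surjective f ∧
      ∀ x y, f x = f y ↔ ∀ i, c i x = c i y := by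
  -- The bouquet is compact, so it embeds in the product of its spheres and continuity can be
  -- checked coordinatewise.
  have hcl : Topology.IsClosedEmbedding (bouquetToPi n d) :=
    continuous_bouquetToPi.isClosedEmbedding bouquetToPi_injective
  have hex : ∀ x, ∃ q, bouquetToPi n d q = fun i => c i x := by
    intro x
    by_cases hx : ∃ i, c i x ≠ sphereBase d
    · obtain ⟨i, hi⟩ := hx
      refine ⟨Quotient.mk _ (Sum.inr ⟨i, c i x⟩), ?_⟩
      rw [bouquetToPi_inr]
      ext1 j
      by_cases hj : j = i
      · subst hj
        simp
      · rw [Function.update_of_ne hj]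
        by_contra hne
        exact hj (hone x j i (Ne.symm hne) hi)
    · push Not at hx
      exact ⟨Quotient.mk _ (Sum.inl ()), bouquetToPi_inl.trans (funext fun i => (hx i).symm)⟩
  choose f hf using hex
  have hfc : Continuous f := by
    rw [hcl.isInducing.continuous_iff]
    have : bouquetToPi n d ∘ f = fun x i => c i x := funext hf
    rw [this]
    exact continuous_pi hc
  have hiff : ∀ x q, f x = q ↔ (fun i => c i x) = bouquetToPi n d q := fun x q => by
    rw [← hf x, bouquetToPi_injective.eq_iff]
  refine ⟨⟨f, hfc⟩, ?_, ?_⟩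
  · have h0 : ∃ x, f x = Quotient.mk _ (Sum.inl ()) := by
      obtain ⟨x, hx⟩ := hbase
      exact ⟨x, (hiff x _).2 (funext hx)⟩
    rintro ⟨⟨⟩ | ⟨i, y⟩⟩
    · exact h0
    · by_cases hy : y = sphereBase d
      · obtain ⟨x, hx⟩ := h0
        refine ⟨x, hx.trans ?_⟩
        subst hy
        exact Quotient.sound (Or.inr ⟨Or.inl rfl, Or.inr ⟨i, rfl⟩⟩)
      · obtain ⟨x, hx⟩ := hsurj i y hy
        refine ⟨x, (hiff x _).2 ?_⟩
        change _ = Function.update (fun _ => sphereBase d) i y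
        ext1 j
        by_cases hj : j = i
        · subst hj
          simp [hx]
        · rw [Function.update_of_ne hj]
          by_contra hne
          exact hj (hone x j i hne (hx.trans_ne hy))
  · intro x y
    change f x = f y ↔ _
    rw [hiff, hf]
    exact funext_iff

end Bouquet

/-! ### Geometric simplices -/

section Cells

variable {V : Type*}

/-- The geometric simplex in `ℝ^V` with vertex set `s`. -/
def cell (s : Finset V) : Set (V → ℝ) :=
  {x | (∀ v, 0 ≤ x v) ∧ (∀ v, v ∉ s → x v = 0) ∧ ∑ v ∈ s, x v = 1}

variable {s t : Finset V} {x : V → ℝ}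

theorem cell_mono (h : s ⊆ t) : cell s ⊆ cell t := by
  rintro x ⟨h0, h1, h2⟩
  refine ⟨h0, fun v hv => h1 v fun hs => hv (h hs), ?_⟩
  rw [← h2]
  exact (Finset.sum_subset h fun v _ hv => h1 v hv).symm

theorem mem_cell_erase [DecidableEq V] {v : V} (hx : x ∈ cell s) (hv : x v = 0) :
    x ∈ cell (s.erase v) := by
  obtain ⟨h0, h1, h2⟩ := hx
  refine ⟨h0, ?_, ?_⟩
  · intro w hw
    by_cases hwv : w = v
    · rw [hwv, hv]
    · exact h1 w fun hs => hw (Finset.mem_erase.2 ⟨hwv, hs⟩)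
  · rw [Finset.sum_erase _ hv, h2]

theorem single_mem_cell [DecidableEq V] {v : V} (hv : v ∈ s) : Pi.single v 1 ∈ cell s := by
  refine ⟨fun w => ?_, fun w hw => ?_, ?_⟩
  · by_cases h : w = v
    · subst h
      simp
    · simp [h]
  · rw [Pi.single_eq_of_ne]
    rintro rfl
    exact hw hv
  · rw [Finset.sum_pi_single']
    simp [hv]

theorem convex_cell (s : Finset V) : Convex ℝ (cell s) := by
  rintro x ⟨h0, h1, h2⟩ y ⟨k0, k1, k2⟩ a b ha hb hab
  refine ⟨fun v => ?_, fun v hv => ?_, ?_⟩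
  · have := h0 v
    have := k0 v
    simp only [Pi.add_apply, Pi.smul_apply, smul_eq_mul]
    positivity
  · simp [h1 v hv, k1 v hv]
  · simp only [Pi.add_apply, Pi.smul_apply, smul_eq_mul]
    rw [Finset.sum_add_distrib, ← Finset.mul_sum, ← Finset.mul_sum, h2, k2, mul_one, mul_one, hab]

theorem isCompact_cell [Finite V] (s : Finset V) : IsCompact (cell s) := by
  have hcl : IsClosed (cell s) := by
    have : cell s = (⋂ v, {x : V → ℝ | 0 ≤ x v}) ∩
        ((⋂ v, ⋂ (_ : v ∉ s), {x : V → ℝ | x v = 0}) ∩ {x | ∑ v ∈ s, x v = 1}) := by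
      ext x
      simp [cell]
    rw [this]
    refine (isClosed_iInter fun v => isClosed_le (by fun_prop) (by fun_prop)).inter
      ((isClosed_iInter fun v => isClosed_iInter fun _ =>
        isClosed_eq (by fun_prop) (by fun_prop)).inter
        (isClosed_eq (by fun_prop) (by fun_prop)))
  refine (isCompact_Icc (a := (0 : V → ℝ)) (b := 1)).of_isClosed_subset hcl ?_
  rintro x ⟨h0, h1, h2⟩
  refine ⟨h0, fun v => ?_⟩
  by_cases hv : v ∈ s
  · rw [Pi.one_apply, ← h2]
    exact Finset.single_le_sum (fun w _ => h0 w) hv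
  · rw [h1 v hv]
    exact zero_le_one

theorem geomRealization_eq_iUnion [Finite V] (K : PreAbstractSimplicialComplex V) :
    geomRealization K = ⋃ s ∈ K.faces, cell s := by
  ext x
  simp only [geomRealization, cell, Set.mem_iUnion, Set.mem_ofPred_eq, exists_prop]

/-! ### Elementary collapses -/

open unitInterval in
/-- Attaching a simplex along the union of some, but not all, of the facets opposite to the
vertices in `R` preserves contractibility. -/
theorem contractibleSpace_union_cell [Finite V] [DecidableEq V] {R : Finset V} {w : V}
    (hR : R.Nonempty) (hRs : R ⊆ s) (hws : w ∈ s) (hwR : w ∉ R) {A : Set (V → ℝ)}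
    (hA : ∀ x ∈ A, (∀ v, 0 ≤ x v) ∧ ∃ v ∈ R, x v = 0)
    (hs : ∀ x ∈ cell s, ∀ v ∈ R, x v = 0 → x ∈ A) [ContractibleSpace A] :
    ContractibleSpace (A ∪ cell s : Set (V → ℝ)) := by
  let m : (V → ℝ) → ℝ := fun x => R.inf' hR fun v => x v
  have hmc : Continuous m := Continuous.finset_inf'_apply hR fun v _ => continuous_apply v
  have hmle : ∀ x, ∀ v ∈ R, m x ≤ x v := fun x v hv => Finset.inf'_le _ hv
  have hm0 : ∀ x : V → ℝ, (∀ v, 0 ≤ x v) → 0 ≤ m x := fun x hx =>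
    Finset.le_inf' _ _ fun v _ => hx v
  have hmA : ∀ x ∈ A, m x = 0 := by
    intro x hx
    obtain ⟨h0, v, hv, hxv⟩ := hA x hx
    exact le_antisymm (hxv ▸ hmle x v hv) (hm0 x h0)
  -- Moving by `m x` along `δ` lowers all coordinates in `R` equally until one vanishes, and hands
  -- the lost mass to `w ∉ R`. On `A` the minimum `m` is zero, so nothing moves.
  let δ : V → ℝ := fun v => (if v = w then (R.card : ℝ) else 0) - if v ∈ R then 1 else 0
  have hδ : ∑ v ∈ s, δ v = 0 := by
    simp only [δ, Finset.sum_sub_distrib, Finset.sum_ite_eq', hws, if_true]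
    rw [← Finset.sum_filter, Finset.filter_mem_eq_inter, Finset.inter_eq_right.2 hRs]
    simp
  let P : I × (V → ℝ) → (V → ℝ) := fun q v => q.2 v + q.1 * m q.2 * δ v
  have hPc : Continuous P := by
    refine continuous_pi fun v => ?_
    have : Continuous fun q : I × (V → ℝ) => m q.2 := hmc.comp continuous_snd
    simp only [P]
    fun_prop
  have hPA : ∀ t, ∀ x ∈ A, P (t, x) = x := by
    intro t x hx
    ext v
    simp [P, hmA x hx]
  have hδR : ∀ v ∈ R, δ v = -1 := by
    intro v hv
    have : v ≠ w := fun h => hwR (h ▸ hv)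
    simp [δ, hv, this]
  have hδn : ∀ v ∉ R, 0 ≤ δ v := by
    intro v hv
    simp only [δ, hv, if_false, sub_zero]
    split_ifs <;> positivity
  have hPs : ∀ t, ∀ x ∈ cell s, P (t, x) ∈ cell s := by
    rintro t x ⟨h0, h1, h2⟩
    refine ⟨fun v => ?_, fun v hv => ?_, ?_⟩
    · simp only [P]
      have ht0 := t.2.1
      have ht1 := t.2.2
      have hm := hm0 x h0
      by_cases hv : v ∈ R
      · rw [hδR v hv]
        nlinarith [hmle x v hv]
      · have := hδn v hv
        have := h0 v
        positivity
    · have hvw : v ≠ w := fun h => hv (h ▸ hws)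
      have hvR : v ∉ R := fun h => hv (hRs h)
      simp [P, δ, h1 v hv, hvw, hvR]
    · simp only [P, Finset.sum_add_distrib, h2, ← Finset.mul_sum, hδ]
      simp
  refine contractibleSpace_of_deformation Set.subset_union_left P hPc ?_ ?_ ?_ (hPA 1)
  · intro x _
    ext v
    simp [P]
  · rintro t x (hx | hx)
    · exact Or.inl ((hPA t x hx).symm ▸ hx)
    · exact Or.inr (hPs t x hx)
  · rintro x (hx | hx)
    · exact (hPA 1 x hx).symm ▸ hx
    · obtain ⟨v, hv, hmv⟩ := Finset.exists_mem_eq_inf' hR fun v => x v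
      refine hs _ (hPs 1 x hx) v hv ?_
      have : m x = x v := hmv
      simp [P, hδR v hv, this]

/-! ### Open simplices -/

/-- Logarithmic coordinates on the interior of a simplex. -/
theorem nonempty_homeomorph_openCell [Finite V] {d : ℕ} (hs : s.card = d + 1) :
    Nonempty ({x : V → ℝ | x ∈ cell s ∧ ∀ v ∈ s, 0 < x v} ≃ₜ EuclideanSpace ℝ (Fin d)) := by
  classical
  let σ : Fin (d + 1) ≃ s := (Finset.equivFinOfCardEq hs).symm
  have hsum : ∀ g : V → ℝ, ∑ v ∈ s, g v = ∑ i, g (σ i) := by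
    intro g
    rw [← Finset.sum_coe_sort]
    exact (σ.sum_comp fun v : s => g v).symm
  -- The inverse is normalized exponentiation; fixing one exponent at `0` removes the scaling
  -- ambiguity.
  let z : (Fin d → ℝ) → Fin (d + 1) → ℝ := fun y => Fin.cons 0 y
  have hzc : ∀ i, Continuous fun y => z y i := by
    intro i
    refine Fin.cases ?_ (fun j => ?_) i
    · exact continuous_const
    · exact continuous_apply j
  let E : (Fin d → ℝ) → ℝ := fun y => ∑ i, Real.exp (z y i)
  have hEc : Continuous E := continuous_finsetSum _ fun i _ => Real.continuous_exp.comp (hzc i)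
  have hE : ∀ y, 0 < E y := fun y =>
    Finset.sum_pos (fun i _ => Real.exp_pos _) Finset.univ_nonempty
  let b : (Fin d → ℝ) → V → ℝ := fun y v =>
    if h : v ∈ s then Real.exp (z y (σ.symm ⟨v, h⟩)) / E y else 0
  have hb : ∀ y i, b y (σ i) = Real.exp (z y i) / E y := by
    intro y i
    simp [b]
  have hbc : Continuous b := by
    refine continuous_pi fun v => ?_
    by_cases hv : v ∈ s
    · simp only [b, hv, dif_pos]
      exact (Real.continuous_exp.comp (hzc _)).div hEc fun y => (hE y).ne'
    · simp only [b, hv, dif_neg, not_false_iff]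
      exact continuous_const
  have hbpos : ∀ y, ∀ v ∈ s, 0 < b y v := by
    intro y v hv
    simp only [b, hv, dif_pos]
    exact div_pos (Real.exp_pos _) (hE y)
  have hbcell : ∀ y, b y ∈ cell s := by
    intro y
    refine ⟨fun v => ?_, fun v hv => by simp [b, hv], ?_⟩
    · by_cases hv : v ∈ s
      · exact (hbpos y v hv).le
      · simp [b, hv]
    · rw [hsum]
      simp only [hb]
      rw [← Finset.sum_div]
      exact div_self (hE y).ne'
  let a : (V → ℝ) → Fin d → ℝ := fun x j => Real.log (x (σ j.succ)) - Real.log (x (σ 0))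
  let e : {x : V → ℝ | x ∈ cell s ∧ ∀ v ∈ s, 0 < x v} ≃ₜ (Fin d → ℝ) :=
    { toFun := fun x => a x.1
      invFun := fun y => ⟨b y, hbcell y, hbpos y⟩
      left_inv := by
        rintro ⟨x, ⟨h0, h1, h2⟩, h3⟩
        have hpos : ∀ i, 0 < x (σ i) := fun i => h3 _ (σ i).2
        have hza : ∀ i, Real.exp (z (a x) i) = x (σ i) / x (σ 0) := by
          intro i
          refine Fin.cases ?_ (fun j => ?_) i
          · simp [z, (hpos 0).ne']
          · simp only [z, Fin.cons_succ, a]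
            rw [Real.exp_sub, Real.exp_log (hpos _), Real.exp_log (hpos _)]
        have hEa : E (a x) = 1 / x (σ 0) := by
          simp only [E, hza]
          rw [← Finset.sum_div, ← hsum, h2]
        refine Subtype.ext (funext fun v => ?_)
        change b (a x) v = x v
        by_cases hv : v ∈ s
        · obtain ⟨i, hi⟩ := σ.surjective ⟨v, hv⟩
          have hiv : ((σ i : s) : V) = v := congrArg Subtype.val hi
          rw [← hiv, hb, hza, hEa]
          have := (hpos 0).ne'
          field_simp
        · simp [b, hv, h1 v hv]
      right_inv := by
        intro y
        ext j
        change a (b y) j = y j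
        simp only [a, hb]
        rw [Real.log_div (Real.exp_pos _).ne' (hE y).ne',
          Real.log_div (Real.exp_pos _).ne' (hE y).ne']
        simp [z]
      continuous_toFun := by
        refine continuous_pi fun j => ?_
        refine Continuous.sub ?_ ?_
        · exact Continuous.log ((continuous_apply _).comp continuous_subtype_val) fun x => (x.2.2 _ (σ _).2).ne'
        · exact Continuous.log ((continuous_apply _).comp continuous_subtype_val) fun x => (x.2.2 _ (σ _).2).ne'
      continuous_invFun := hbc.subtype_mk _ }
  exact ⟨e.trans (EuclideanSpace.equiv (Fin d) ℝ).symm.toHomeomorph⟩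

/-- Stereographic projection from the base point. -/
theorem nonempty_homeomorph_compl_sphereBase (d : ℕ) :
    Nonempty (EuclideanSpace ℝ (Fin d) ≃ₜ ({sphereBase d}ᶜ : Set (unitSphere d))) := by
  have : Fact (Module.finrank ℝ (EuclideanSpace ℝ (Fin (d + 1))) = d + 1) :=
    ⟨finrank_euclideanSpace_fin⟩
  let φ := stereographic' d (sphereBase d)
  have h1 : φ.source = {sphereBase d}ᶜ := stereographic'_source _
  have h2 : φ.target = Set.univ := stereographic'_target _
  exact ⟨(Homeomorph.Set.univ _).symm.trans ((Homeomorph.setCongr h2.symm).trans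
    (φ.toHomeomorphSourceTarget.symm.trans (Homeomorph.setCongr h1)))⟩

end Cells

section AttachCells

open unitInterval

variable {V : Type*}

/-- Attaching `n` simplices of dimension `d` along their whole boundaries to a contractible space
gives a bouquet of `n` spheres of dimension `d`. -/
theorem nonempty_homotopyEquiv_sphereBouquet [Finite V] {n d : ℕ} (s : Fin n → Finset V)
    (hs : ∀ i, (s i).card = d + 1) (hne : ∀ i j, s j ⊆ s i → i = j) (A : Set (V → ℝ))
    [ContractibleSpace A] (hA : ∀ x ∈ A, (∀ v, 0 ≤ x v) ∧ ∀ i, ∃ v ∈ s i, x v = 0)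
    (hbd : ∀ i, ∀ x ∈ cell (s i), ∀ v ∈ s i, x v = 0 → x ∈ A)
    (hcomp : IsCompact (A ∪ ⋃ i, cell (s i))) :
    Nonempty ((A ∪ ⋃ i, cell (s i) : Set (V → ℝ)) ≃ₕ sphereBouquet n d) := by
  classical
  set Z : Set (V → ℝ) := A ∪ ⋃ i, cell (s i) with hZ
  have hsne : ∀ i, (s i).Nonempty := fun i => Finset.card_pos.1 (by rw [hs i]; omega)
  -- The open simplices.
  have hopen : ∀ i, ∀ x ∈ Z, (∀ v ∈ s i, 0 < x v) → x ∈ cell (s i) := by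
    rintro i x (hx | hx) hpos
    · obtain ⟨v, hv, h0⟩ := (hA x hx).2 i
      exact absurd h0 (hpos v hv).ne'
    · obtain ⟨j, hj⟩ := Set.mem_iUnion.1 hx
      have : j = i := hne j i fun v hv => by
        by_contra h
        exact (hpos v hv).ne' (hj.2.1 v h)
      exact this ▸ hj
  have hcell : ∀ i, cell (s i) ⊆ Z := fun i x hx => Or.inr (Set.mem_iUnion.2 ⟨i, hx⟩)
  have huniq : ∀ i j x, x ∈ Z → (∀ v ∈ s i, 0 < x v) → (∀ v ∈ s j, 0 < x v) → i = j := by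
    intro i j x hx hi hj
    refine hne i j fun v hv => ?_
    by_contra h
    exact (hj v hv).ne' ((hopen i x hx hi).2.1 v h)
  have hZ0 : ∀ x ∈ Z, ∀ v, 0 ≤ x v := by
    rintro x (hx | hx)
    · exact (hA x hx).1
    · obtain ⟨j, hj⟩ := Set.mem_iUnion.1 hx
      exact hj.1
  have hcases : ∀ x ∈ Z, x ∈ A ∨ ∃ i, ∀ v ∈ s i, 0 < x v := by
    rintro x (hx | hx)
    · exact Or.inl hx
    · obtain ⟨i, hi⟩ := Set.mem_iUnion.1 hx
      by_cases h : ∃ v ∈ s i, x v = 0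
      · obtain ⟨v, hv, h0⟩ := h
        exact Or.inl (hbd i x hi v hv h0)
      · push Not at h
        exact Or.inr ⟨i, fun v hv => lt_of_le_of_ne (hi.1 v) (Ne.symm (h v hv))⟩
  have : CompactSpace Z := isCompact_iff_compactSpace.1 hcomp
  -- The quotient map to the bouquet.
  let U : Fin n → Set Z := fun i => {x | ∀ v ∈ s i, 0 < x.1 v}
  have hUo : ∀ i, IsOpen (U i) := by
    intro i
    have : U i = ⋂ v ∈ s i, {x : Z | 0 < x.1 v} := by
      ext x
      simp [U]
    rw [this]
    exact isOpen_biInter_finset fun v _ => isOpen_lt continuous_const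
      ((continuous_apply v).comp continuous_subtype_val)
  have he : ∀ i, Nonempty (U i ≃ₜ ({sphereBase d}ᶜ : Set (unitSphere d))) := by
    intro i
    obtain ⟨e₁⟩ := nonempty_homeomorph_openCell (hs i)
    obtain ⟨e₂⟩ := nonempty_homeomorph_compl_sphereBase d
    let e₀ : U i ≃ₜ {x : V → ℝ | x ∈ cell (s i) ∧ ∀ v ∈ s i, 0 < x v} :=
      { toFun := fun x => ⟨x.1.1, hopen i x.1.1 x.1.2 x.2, x.2⟩
        invFun := fun x => ⟨⟨x.1, hcell i x.2.1⟩, x.2.2⟩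
        left_inv := fun x => rfl
        right_inv := fun x => rfl
        continuous_toFun := by fun_prop
        continuous_invFun := by fun_prop }
    exact ⟨e₀.trans (e₁.trans e₂)⟩
  have e : ∀ i, U i ≃ₜ ({sphereBase d}ᶜ : Set (unitSphere d)) := fun i => (he i).some
  let c : Fin n → Z → unitSphere d := fun i x =>
    if hx : x ∈ U i then (e i ⟨x, hx⟩ : ({sphereBase d}ᶜ : Set (unitSphere d))) else sphereBase d
  have hcU : ∀ i x (hx : x ∈ U i),
      c i x = (e i ⟨x, hx⟩ : ({sphereBase d}ᶜ : Set (unitSphere d))) := fun i x hx => dif_pos hx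
  have hcn : ∀ i, ∀ x ∉ U i, c i x = sphereBase d := fun i x hx => dif_neg hx
  have hcne : ∀ i x, c i x ≠ sphereBase d ↔ x ∈ U i := by
    intro i x
    constructor
    · intro h
      by_contra hx
      exact h (hcn i x hx)
    · intro hx
      rw [hcU i x hx]
      exact (e i ⟨x, hx⟩).2
  obtain ⟨p⟩ := (inferInstance : Nonempty A)
  have hAU : ∀ x : Z, x.1 ∈ A → ∀ i, x ∉ U i := by
    intro x hx i hxU
    obtain ⟨v, hv, h0⟩ := (hA x.1 hx).2 i
    exact (hxU v hv).ne' h0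
  obtain ⟨f, hfs, hf⟩ := exists_map_to_bouquet c
    (fun i => continuous_extend_const (hUo i) (sphereBase d) (e i) (hcU i) (hcn i))
    (fun x i j hi hj => huniq i j x.1 x.2 ((hcne i x).1 hi) ((hcne j x).1 hj))
    ⟨⟨p.1, Or.inl p.2⟩, fun i => hcn i _ (hAU _ p.2 i)⟩
    (fun i y hy => ⟨(e i).symm ⟨y, hy⟩, by
      rw [hcU i _ ((e i).symm ⟨y, hy⟩).2]
      simp⟩)
  -- The deformation of a neighbourhood of `A` into `A`.
  let N : ℝ := d + 1
  have hN : 0 < N := by positivity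
  -- On the `i`th simplex this is `1` at the barycentre and `0` on the boundary.
  let m : Fin n → (V → ℝ) → ℝ := fun i x => N * (s i).inf' (hsne i) fun v => x v
  have hmc : ∀ i, Continuous (m i) := fun i =>
    continuous_const.mul (Continuous.finset_inf'_apply (hsne i) fun v _ => continuous_apply v)
  have hmle : ∀ i x, ∀ v ∈ s i, m i x ≤ N * x v := fun i x v hv =>
    mul_le_mul_of_nonneg_left (Finset.inf'_le _ hv) hN.le
  have hm0 : ∀ i, ∀ x ∈ Z, 0 ≤ m i x := fun i x hx =>
    mul_nonneg hN.le (Finset.le_inf' _ _ fun v _ => hZ0 x hx v)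
  have hmz : ∀ i, ∀ x ∈ Z, (¬ ∀ v ∈ s i, 0 < x v) → m i x = 0 := by
    intro i x hx h
    push Not at h
    obtain ⟨v, hv, hxv⟩ := h
    refine le_antisymm ((hmle i x v hv).trans ?_) (hm0 i x hx)
    exact mul_nonpos_of_nonneg_of_nonpos hN.le hxv
  -- Dilation factor from the barycentre. A point with `m i x = a < 1` reaches the boundary at
  -- factor `1 / (1 - a)`; the floor `1/4` avoids dividing by zero at the barycentre, and the cap `1
  -- + t` starts at the identity and reaches `2`, which suffices for `a ≤ 1/2`.
  let ρ : ℝ → ℝ → ℝ := fun a t => min (1 / max (1 - a) (1 / 4)) (1 + t)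
  have hρ0 : ∀ t, 0 ≤ t → ρ 0 t = 1 := by
    intro t ht
    simp only [ρ, sub_zero]
    rw [max_eq_left (by norm_num), div_one]
    exact min_eq_left (by linarith)
  let b : Fin n → V → ℝ := fun i v => if v ∈ s i then 1 / N else 0
  let P : I × (V → ℝ) → (V → ℝ) := fun q v =>
    q.2 v + ∑ i, (ρ (m i q.2) q.1 - 1) * (q.2 v - b i v)
  have hPc : Continuous P := by
    refine continuous_pi fun v => ?_
    refine Continuous.add (by fun_prop) (continuous_finsetSum _ fun i _ => ?_)
    have h1 : Continuous fun q : I × (V → ℝ) => m i q.2 := (hmc i).comp continuous_snd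
    have h2 : Continuous fun q : I × (V → ℝ) => 1 / max (1 - m i q.2) (1 / 4) := by
      refine Continuous.div continuous_const (by fun_prop) fun q => ?_
      exact (lt_of_lt_of_le (by norm_num) (le_max_right _ _)).ne'
    have h3 : Continuous fun q : I × (V → ℝ) => ρ (m i q.2) q.1 :=
      h2.min (by fun_prop)
    exact (h3.sub continuous_const).mul (by fun_prop)
  have hPA : ∀ t, ∀ x ∈ A, P (t, x) = x := by
    intro t x hx
    ext v
    have : ∀ i, m i x = 0 := fun i =>
      hmz i x (Or.inl hx) (hAU ⟨x, Or.inl hx⟩ hx i)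
    simp [P, this, hρ0 t t.2.1]
  have hPU : ∀ i t x, x ∈ Z → (∀ v ∈ s i, 0 < x v) → ∀ v,
      P (t, x) v = x v + (ρ (m i x) t - 1) * (x v - b i v) := by
    intro i t x hx hpos v
    simp only [P]
    rw [Finset.sum_eq_single i]
    · intro j _ hji
      have : m j x = 0 := hmz j x hx fun h => hji (huniq j i x hx h hpos)
      rw [this, hρ0 t t.2.1]
      ring
    · simp
  have hPin : ∀ i t x, x ∈ Z → (∀ v ∈ s i, 0 < x v) → P (t, x) ∈ cell (s i) := by
    intro i t x hx hpos
    obtain ⟨h0, h1, h2⟩ := hopen i x hx hpos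
    have hP := hPU i t x hx hpos
    refine ⟨fun v => ?_, fun v hv => ?_, ?_⟩
    · rw [hP v]
      by_cases hv : v ∈ s i
      · have hmax : (0 : ℝ) < max (1 - m i x) (1 / 4) :=
          lt_of_lt_of_le (by norm_num) (le_max_right _ _)
        have hρpos : 0 ≤ ρ (m i x) t := le_min (by positivity) (by linarith [t.2.1])
        have hρle : ρ (m i x) t * (1 - m i x) ≤ 1 := by
          calc ρ (m i x) t * (1 - m i x) ≤ ρ (m i x) t * max (1 - m i x) (1 / 4) :=
                mul_le_mul_of_nonneg_left (le_max_left _ _) hρpos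
            _ ≤ 1 / max (1 - m i x) (1 / 4) * max (1 - m i x) (1 / 4) :=
                mul_le_mul_of_nonneg_right (min_le_left _ _) hmax.le
            _ = 1 := by field_simp
        simp only [b, hv, if_true]
        have hm := hmle i x v hv
        have hm' := mul_le_mul_of_nonneg_left hm hρpos
        have : 0 ≤ N * (x v + (ρ (m i x) t - 1) * (x v - 1 / N)) := by
          have : N * (x v + (ρ (m i x) t - 1) * (x v - 1 / N)) =
              ρ (m i x) t * (N * x v) + 1 - ρ (m i x) t := by
            field_simp
            ring
          rw [this]
          linarith
        exact nonneg_of_mul_nonneg_right this hN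
      · simp [b, hv, h1 v hv]
    · rw [hP v]
      simp [b, hv, h1 v hv]
    · simp only [hP, Finset.sum_add_distrib, ← Finset.mul_sum, Finset.sum_sub_distrib, h2]
      have : ∑ v ∈ s i, b i v = 1 := by
        rw [Finset.sum_congr rfl fun v hv => if_pos hv]
        simp only [Finset.sum_const, hs i, N]
        rw [nsmul_eq_mul]
        push_cast
        field_simp
      rw [this]
      ring
  have hPZ : ∀ t, ∀ x ∈ Z, P (t, x) ∈ Z := by
    intro t x hx
    rcases hcases x hx with hxA | ⟨i, hi⟩
    · rw [hPA t x hxA]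
      exact hx
    · exact hcell i (hPin i t x hx hi)
  have hP0 : ∀ x ∈ Z, P (0, x) = x := by
    intro x hx
    rcases hcases x hx with hxA | ⟨i, hi⟩
    · exact hPA 0 x hxA
    · ext v
      rw [hPU i 0 x hx hi v]
      have hρ1 : ρ (m i x) (0 : I) = 1 := by
        have h1 : max (1 - m i x) (1 / 4) ≤ 1 :=
          max_le (by linarith [hm0 i x hx]) (by norm_num)
        have h2 : (0 : ℝ) < max (1 - m i x) (1 / 4) :=
          lt_of_lt_of_le (by norm_num) (le_max_right _ _)
        simp only [ρ, Set.Icc.coe_zero, add_zero]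
        exact min_eq_right ((one_le_div h2).2 h1)
      rw [hρ1]
      ring
  have hP1 : ∀ x ∈ Z, ∑ i, m i x ≤ 1 / 2 → P (1, x) ∈ A := by
    intro x hx hu
    rcases hcases x hx with hxA | ⟨i, hi⟩
    · rw [hPA 1 x hxA]
      exact hxA
    · have hmi : m i x ≤ 1 / 2 :=
        (Finset.single_le_sum (fun j _ => hm0 j x hx) (Finset.mem_univ i)).trans hu
      obtain ⟨v, hv, hmv⟩ := Finset.exists_mem_eq_inf' (hsne i) fun v => x v
      have hmv : m i x = N * x v := congrArg (N * ·) hmv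
      refine hbd i _ (hPin i 1 x hx hi) v hv ?_
      rw [hPU i 1 x hx hi v]
      have hpos : 0 < 1 - m i x := by linarith
      have hρ1 : ρ (m i x) (1 : I) = 1 / (1 - m i x) := by
        simp only [ρ, Set.Icc.coe_one]
        rw [max_eq_left (by linarith)]
        refine min_eq_left ?_
        rw [div_le_iff₀ hpos]
        linarith
      have hxv : x v = m i x / N := by
        rw [hmv]
        field_simp
      rw [hρ1, hxv]
      simp only [b, hv, if_true]
      field_simp
      ring
  have : ContractibleSpace (Subtype.val ⁻¹' A : Set Z) := by
    let ε : (Subtype.val ⁻¹' A : Set Z) ≃ₜ A :=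
      { toFun := fun x => ⟨x.1.1, x.2⟩
        invFun := fun x => ⟨⟨x.1, Or.inl x.2⟩, x.2⟩
        left_inv := fun x => rfl
        right_inv := fun x => rfl
        continuous_toFun := by fun_prop
        continuous_invFun := by fun_prop }
    exact ε.contractibleSpace
  obtain ⟨H, H0, HA, H1⟩ := exists_homotopy_const_on (A := (Subtype.val ⁻¹' A : Set Z))
    ⟨fun x => ∑ i, m i x.1, continuous_finsetSum _ fun i _ =>
      (hmc i).comp continuous_subtype_val⟩
    (fun x hx => Finset.sum_eq_zero fun i _ => hmz i x.1 x.2 (hAU x hx i))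
    ⟨fun q => ⟨P (q.1, q.2.1), hPZ q.1 q.2.1 q.2.2⟩, by fun_prop⟩
    (fun x => Subtype.ext (hP0 x.1 x.2)) (fun t x hx => Subtype.ext (hPA t x.1 hx))
    (fun x hx => hP1 x.1 x.2 hx)
  refine nonempty_homotopyEquiv_of_collapse f hfs ?_ ?_ H H0 HA H1
  · intro x hx y hy
    rw [hf]
    intro i
    rw [hcn i x (hAU x hx i), hcn i y (hAU y hy i)]
  · intro x y hxy
    rw [hf] at hxy
    rcases hcases x.1 x.2 with hx | ⟨i, hi⟩
    · rcases hcases y.1 y.2 with hy | ⟨i, hi⟩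
      · exact Or.inr ⟨hx, hy⟩
      · have := (hcne i y).2 hi
        rw [← hxy i] at this
        exact absurd ((hcne i x).1 this) (hAU x hx i)
    · have hxU : x ∈ U i := hi
      have hyU : y ∈ U i := (hcne i y).1 (hxy i ▸ (hcne i x).2 hxU)
      have := hxy i
      rw [hcU i x hxU, hcU i y hyU] at this
      left
      exact congrArg Subtype.val ((e i).injective (Subtype.ext this))

end AttachCells

/-! ### Shellable complexes are bouquets of spheres -/

/-- The spheres are counted by the facets with `R i = F i`; the remaining facets, in shelling order,
build a contractible space containing the boundaries of these. -/
theorem IsShellable.exists_homotopyEquiv_sphereBouquet {V : Type*} [Finite V]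
    {K : PreAbstractSimplicialComplex V} (hK : IsShellable K) {d : ℕ} {s₀ : Finset V}
    (hs₀ : s₀ ∈ facetSet K) (hd : s₀.card = d + 1) :
    ∃ n : ℕ, Nonempty (geomRealization K ≃ₕ sphereBouquet n d) := by
  classical
  obtain ⟨hfin, N, hcard, m, F, hinj, hrange, hsh⟩ := hK
  obtain rfl : N = d + 1 := (hcard s₀ hs₀).symm.trans hd
  have hFK : ∀ j, F j ∈ facetSet K := fun j => hrange ▸ Set.mem_range_self j
  have hF : ∀ j, (F j).card = d + 1 := fun j => hcard _ (hFK j)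
  have hFeq : ∀ i j, F i ⊆ F j → i = j := fun i j h =>
    hinj (Finset.eq_of_subset_of_card_le h (by rw [hF, hF]))
  have hm : 0 < m := by
    obtain ⟨j, -⟩ := (hrange ▸ hs₀ : s₀ ∈ Set.range F)
    exact j.pos
  -- The faces of `F j` that are not faces of earlier facets are those containing `R j`.
  let R : Fin m → Finset V := fun j => (F j).filter fun v => ∃ i < j, (F j).erase v ⊆ F i
  have hRF : ∀ j, R j ⊆ F j := fun j => Finset.filter_subset _ _
  have hR : ∀ j t, t ⊆ F j → ((∃ i < j, t ⊆ F i) ↔ ∃ v ∈ R j, v ∉ t) := by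
    intro j t htj
    constructor
    · rintro ⟨i, hij, hti⟩
      have hfin' : {t | t ⊆ F j ∧ ∃ i < j, t ⊆ F i}.Finite :=
        (Finset.finite_toSet (F j).powerset).subset fun t ht =>
          Finset.mem_coe.2 (Finset.mem_powerset.2 ht.1)
      obtain ⟨u, htu, hu⟩ := hfin'.exists_le_maximal
        (show t ∈ {t | t ⊆ F j ∧ ∃ i < j, t ⊆ F i} from ⟨htj, i, hij, hti⟩)
      have hj0 : 0 < (j : ℕ) := lt_of_le_of_lt (Nat.zero_le _) (Fin.lt_def.1 hij)
      have hucard := hsh j hj0 u hu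
      have hnot : ¬ F j ⊆ u := fun h => by
        have := Finset.card_le_card h
        rw [hF] at this
        omega
      obtain ⟨v, hv, hvu⟩ := Finset.not_subset.1 hnot
      have hue : u = (F j).erase v := by
        refine Finset.eq_of_subset_of_card_le (fun w hw => Finset.mem_erase.2
          ⟨fun h => hvu (h ▸ hw), hu.1.1 hw⟩) ?_
        rw [Finset.card_erase_of_mem hv, hF]
        omega
      exact ⟨v, Finset.mem_filter.2 ⟨hv, hue ▸ hu.1.2⟩, fun h => hvu (htu h)⟩
    · rintro ⟨v, hv, hvt⟩
      obtain ⟨-, i, hij, hi⟩ := Finset.mem_filter.1 hv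
      exact ⟨i, hij, fun w hw => hi (Finset.mem_erase.2 ⟨fun h => hvt (h ▸ hw), htj hw⟩)⟩
  -- A proper face of a facet with `R i = F i` lies in an earlier facet; descending the shelling
  -- ends at a facet of the other kind. Hence omitting the sphere facets loses none of their proper
  -- faces.
  have hnonsp : ∀ i t, t ⊆ F i → (∃ i' ≤ i, R i' ≠ F i' ∧ t ⊆ F i') ∨ (R i = F i ∧ t = F i) := by
    intro i
    induction i using WellFoundedLT.induction with
    | _ i ih =>
      intro t ht
      by_cases hi : R i = F i
      · by_cases hti : t = F i
        · exact Or.inr ⟨hi, hti⟩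
        have hnot : ¬ F i ⊆ t := fun h => hti (Finset.Subset.antisymm ht h)
        obtain ⟨v, hv, hvt⟩ := Finset.not_subset.1 hnot
        obtain ⟨l, hl, htl⟩ := (hR i t ht).2 ⟨v, hi.symm ▸ hv, hvt⟩
        rcases ih l hl t htl with ⟨i', hi', h⟩ | ⟨-, rfl⟩
        · exact Or.inl ⟨i', hi'.trans hl.le, h⟩
        · exact absurd (hFeq _ _ ht) hl.ne
      · exact Or.inl ⟨i, le_rfl, hi, ht⟩
  have hface : ∀ j, ∀ v ∈ R j, ∃ i < j, R i ≠ F i ∧ (F j).erase v ⊆ F i := by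
    intro j v hv
    obtain ⟨hvF, i, hij, hi⟩ := Finset.mem_filter.1 hv
    rcases hnonsp i _ hi with ⟨i', hi', h⟩ | ⟨-, h⟩
    · exact ⟨i', hi'.trans_lt hij, h⟩
    · have := congrArg Finset.card h
      rw [Finset.card_erase_of_mem hvF, hF, hF] at this
      omega
  have hsupp : ∀ i (t : Finset V), ∀ x ∈ cell (F i), ¬ t ⊆ F i → ∃ v ∈ t, x v = 0 := by
    intro i t x hx ht
    obtain ⟨v, hv, hvi⟩ := Finset.not_subset.1 ht
    exact ⟨v, hv, hx.2.1 v hvi⟩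
  -- The facets of `F j` other than those with `R j = F j` form a contractible complex.
  let A : ℕ → Set (V → ℝ) := fun j => {x | ∃ i : Fin m, i.val < j ∧ R i ≠ F i ∧ x ∈ cell (F i)}
  let j₀ : Fin m := ⟨0, hm⟩
  have hj₀ : R j₀ ≠ F j₀ := by
    have h0 : R j₀ = ∅ := by
      refine Finset.filter_eq_empty_iff.2 ?_
      rintro v - ⟨i, hi, -⟩
      exact absurd (Fin.lt_def.1 hi) (Nat.not_lt_zero _)
    rw [h0]
    intro h
    have := hF j₀
    rw [← h] at this
    simp at this
  have hA1 : A 1 = cell (F j₀) := by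
    ext x
    constructor
    · rintro ⟨i, hi, -, hx⟩
      have : i = j₀ := Fin.ext (Nat.lt_one_iff.1 hi)
      exact this ▸ hx
    · exact fun hx => ⟨j₀, Nat.one_pos, hj₀, hx⟩
  have hAc : ∀ j, 1 ≤ j → j ≤ m → ContractibleSpace (A j) := by
    intro j hj
    induction j, hj using Nat.le_induction with
    | base =>
      intro _
      rw [hA1]
      obtain ⟨v, hv⟩ := Finset.card_pos.1 (by rw [hF]; omega : 0 < (F j₀).card)
      exact (convex_cell (F j₀)).contractibleSpace ⟨_, single_mem_cell hv⟩
    | succ j hj ih =>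
      intro hjm
      have := ih (by omega)
      let J : Fin m := ⟨j, hjm⟩
      by_cases hJ : R J = F J
      · have : A (j + 1) = A j := by
          ext x
          constructor
          · rintro ⟨i, hi, hne, hx⟩
            refine ⟨i, lt_of_le_of_ne (Nat.lt_succ_iff.1 hi) ?_, hne, hx⟩
            intro h
            have : i = J := Fin.ext h
            exact hne (this ▸ hJ)
          · rintro ⟨i, hi, h⟩
            exact ⟨i, by omega, h⟩
        rwa [this]
      · have : A (j + 1) = A j ∪ cell (F J) := by
          ext x
          constructor
          · rintro ⟨i, hi, hne, hx⟩
            rcases (Nat.lt_succ_iff.1 hi).lt_or_eq with h | h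
            · exact Or.inl ⟨i, h, hne, hx⟩
            · have : i = J := Fin.ext h
              exact Or.inr (this ▸ hx)
          · rintro (⟨i, hi, h⟩ | hx)
            · exact ⟨i, by omega, h⟩
            · exact ⟨J, Nat.lt_succ_self j, hJ, hx⟩
        rw [this]
        -- Past the first facet the empty face is already shared, so `R J` is nonempty.
        obtain ⟨v, hv, -⟩ := (hR J ∅ (Finset.empty_subset _)).1
          ⟨j₀, Fin.lt_def.2 hj, Finset.empty_subset _⟩
        obtain ⟨w, hw, hwR⟩ := Finset.not_subset.1
          fun h => hJ (Finset.Subset.antisymm (hRF J) h)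
        refine contractibleSpace_union_cell ⟨v, hv⟩ (hRF J) hw hwR ?_ ?_
        · rintro x ⟨i, hi, -, hx⟩
          -- `R J` itself is contained in no earlier facet, so every point of an earlier cell
          -- vanishes at some vertex of `R J`.
          refine ⟨hx.1, hsupp i (R J) x hx fun h => ?_⟩
          obtain ⟨u, hu, hu'⟩ := (hR J (R J) (hRF J)).1 ⟨i, hi, h⟩
          exact hu' hu
        · intro x hx u hu hxu
          obtain ⟨i, hi, hne, hsub⟩ := hface J u hu
          exact ⟨i, hi, hne, cell_mono hsub (mem_cell_erase hx hxu)⟩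
  have := hAc m hm le_rfl
  let e : Fin (Fintype.card {i // R i = F i}) ≃ {i // R i = F i} := (Fintype.equivFin _).symm
  have hZ : A m ∪ ⋃ i, cell (F (e i)) = geomRealization K := by
    rw [geomRealization_eq_iUnion]
    ext x
    simp only [Set.mem_union, Set.mem_iUnion, exists_prop]
    constructor
    · rintro (⟨i, -, -, hx⟩ | ⟨i, hx⟩)
      · exact ⟨_, (hFK i).1, hx⟩
      · exact ⟨_, (hFK _).1, hx⟩
    · rintro ⟨t, ht, hx⟩
      obtain ⟨u, htu, hu⟩ := hfin.exists_le_maximal ht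
      obtain ⟨i, rfl⟩ := (hrange.symm ▸ hu : u ∈ Set.range F)
      have hxi := cell_mono htu hx
      by_cases hi : R i = F i
      · refine Or.inr ⟨e.symm ⟨i, hi⟩, ?_⟩
        simpa using hxi
      · exact Or.inl ⟨i, i.2, hi, hxi⟩
  have hcomp : IsCompact (geomRealization K) := by
    rw [geomRealization_eq_iUnion]
    exact hfin.isCompact_biUnion fun s _ => isCompact_cell s
  refine ⟨Fintype.card {i // R i = F i}, ?_⟩
  rw [← hZ] at hcomp ⊢
  refine nonempty_homotopyEquiv_sphereBouquet (fun i => F (e i)) (fun i => hF _) ?_ (A m) ?_ ?_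
    hcomp
  · intro i j h
    exact (e.injective (Subtype.ext (hFeq _ _ h))).symm
  · rintro x ⟨i, -, hne, hx⟩
    refine ⟨hx.1, fun j => hsupp i _ x hx fun h => ?_⟩
    have hij := hFeq _ _ h
    exact hne (hij ▸ (e j).2)
  · intro j x hx v hv hxv
    obtain ⟨i, hi, hne, hsub⟩ := hface (e j) v ((e j).2.symm ▸ hv)
    exact ⟨i, i.2, hne, cell_mono hsub (mem_cell_erase hx hxv)⟩

/-! ### Chordal building sets: the main theorem -/

theorem theorem3p3 {α : Type*} [LinearOrder α] (k : ℕ) (S : Finset α) (B : Set (Finset α))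
    (hS : S.card = 2 * k) (hB : IsBuildingSet S B) (hchordal : IsChordal B)
    (heven : NoOddComponent B) :
    IsShellable (orderComplex (properPart S B)) ∧
      ∀ d : ℕ, k = d + 2 →
        ∃ alt : ℕ, Nonempty
          (geomRealization (orderComplex (properPart S B)) ≃ₕ sphereBouquet alt d) := by
  have hsh := hB.isShellable_orderComplex hchordal heven k hS
  refine ⟨hsh, ?_⟩
  rintro d rfl
  obtain ⟨s, hs, hcard⟩ := hB.exists_facet hchordal heven d hS
  exact hsh.exists_homotopyEquiv_sphereBouquet hs hcard
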